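/- **Proposition 3.6 (LC-connection-matrix).** Let $X$ be an oriented smooth 4-manifold and let $\underline\omega=(\omega_1,\omega_2,\omega_3)$ be a hypersymplectic structure on $X$: a triple of smooth closed 2-forms which at every point is linearly independent and spans a (maximal) positive-definite subspace of $\Lambda^2$ for the wedge product. Let $$\beta(v,w)=\tfrac16\,\epsilon_{ijk}\,\iota_v\omega_i\wedge\iota_w\omega_j\wedge\omega_k ,$$ and let $g$ and $\mu$ be the Riemannian metric and the volume form induced by $\underline\omega$, i.e. the unique pair consisting of a Riemannian metric $g$ and a volume form $\mu$ of $g$ with $g\otimes\mu=\beta$. Put $Q_{ij}=\dfrac{\omega_i\wedge\omega_j}{2\mu}$, write $Q^{kl}$ for the entries of $Q^{-1}$, let $*$ be the Hodge star of $(g,\mu)$, and define $$E_i(\alpha)=-*(\alpha\wedge\omega_i)\quad(\alpha\in\Lambda^1),\qquad \tau_i=-E_k\big((dQ\,Q^{-1})_{ik}\big),\qquad X_{ij}=\tfrac12\,\epsilon_{ijk}\,Q^{kl}\,\tau_l$$ (repeated indices are summed over $1,2,3$). Then $\omega_1,\omega_2,\omega_3$ is a framing of the bundle $\Lambda^+$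 of self-dual 2-forms of $g$ and the orientation of $X$, and if $\nabla$ is the Levi-Civita connection of $g$, there is exactly one matrix $a=(a_{ij})$ of 1-forms with $\nabla\omega_i=a_{ij}\otimes\omega_j$, namely $$a_{ij}=\tfrac12\,(dQ\,Q^{-1})_{ij}+(XQ^{-1})_{ij}.$$ -/

import Mathlib

open scoped Manifold ContDiff

noncomputable section

namespace Hypersymplectic

/-! ### Exterior algebra of a real vector space

A `k`-covector of `V` is an alternating map `V [⋀^Fin k]→ₗ[ℝ] ℝ`. -/

section Pointwise

variable {V : Type*} [AddCommGroup V] [Module ℝ V]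

/-- The wedge product, `(α ∧ β)(v) = ∑ sign(σ) α(v_σ(1), …, v_σ(k)) β(v_σ(k+1), …)`, the sum being
over the `(k, l)`-shuffles `σ`; e.g. `(α ∧ β)(u, v) = α(u) β(v) - α(v) β(u)` for 1-covectors. -/
def wedge {k l : ℕ} (α : V [⋀^Fin k]→ₗ[ℝ] ℝ) (β : V [⋀^Fin l]→ₗ[ℝ] ℝ) :
    V [⋀^Fin (k + l)]→ₗ[ℝ] ℝ :=
  ((LinearMap.mul' ℝ ℝ).compAlternatingMap (α.domCoprod β)).domDomCongr finSumFinEquiv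

/-- A linear form regarded as a 1-covector. -/
def oneForm (α : V →ₗ[ℝ] ℝ) : V [⋀^Fin 1]→ₗ[ℝ] ℝ :=
  AlternatingMap.ofSubsingleton ℝ V ℝ 0 α

/-- A 1-covector regarded as a linear form. -/
def linearForm (α : V [⋀^Fin 1]→ₗ[ℝ] ℝ) : V →ₗ[ℝ] ℝ :=
  (AlternatingMap.ofSubsingleton ℝ V ℝ 0).symm α

/-- Insertion of `k` vectors into the first `k` slots: `(v_1, …) ↦ ν(w_0, …, w_{k-1}, v_1, …)`. -/
def contract {l : ℕ} : (k : ℕ) → (V [⋀^Fin (l + k)]→ₗ[ℝ] ℝ) → (Fin k → V) →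
    V [⋀^Fin l]→ₗ[ℝ] ℝ
  | 0, ν, _ => ν
  | k + 1, ν, w => contract k (ν.curryLeft (w 0)) (Fin.tail w)

/-- The Gram matrix of a bilinear form in a basis. -/
def gram {n : ℕ} (b : Module.Basis (Fin n) ℝ V) (g : V → V → ℝ) : Matrix (Fin n) (Fin n) ℝ :=
  Matrix.of fun p q => g (b p) (b q)

/-- The Hodge star of the metric `g` and the volume form `ν` on a space with basis `b`:
`(*ψ)_{q…} = (1/k!) ψ^{p_1 … p_k} ν_{p_1 … p_k q …}`, indices being raised with the inverse of `g`.
It does not depend on `b`, and `χ ∧ *ψ = ⟨χ, ψ⟩ ν`. -/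
def hodgeStar {k l : ℕ} (b : Module.Basis (Fin (l + k)) ℝ V) (g : V → V → ℝ)
    (ν : V [⋀^Fin (l + k)]→ₗ[ℝ] ℝ) (ψ : V [⋀^Fin k]→ₗ[ℝ] ℝ) : V [⋀^Fin l]→ₗ[ℝ] ℝ :=
  (1 / (k.factorial : ℝ)) • ∑ p : Fin k → Fin (l + k), ∑ q : Fin k → Fin (l + k),
    ((∏ i, (gram b g)⁻¹ (p i) (q i)) * ψ (b ∘ q)) • contract k ν (b ∘ p)

/-- The sign `ε_{ijk}` of `(i, j, k)` as a permutation of the three indices, `0` if two agree. -/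
def eps (i j k : Fin 3) : ℝ :=
  (((j : ℕ) : ℝ) - ((i : ℕ) : ℝ)) * (((k : ℕ) : ℝ) - ((i : ℕ) : ℝ)) *
    (((k : ℕ) : ℝ) - ((j : ℕ) : ℝ)) / 2

/-- The `Λ⁴`-valued bilinear form of a triple of 2-covectors:
`β(v, w) = (1/6) ∑ ε_{ijk} ι_v Ω_i ∧ ι_w Ω_j ∧ Ω_k`. -/
def beta (Ω : Fin 3 → V [⋀^Fin 2]→ₗ[ℝ] ℝ) (v w : V) : V [⋀^Fin 4]→ₗ[ℝ] ℝ :=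
  (1 / 6 : ℝ) • ∑ i, ∑ j, ∑ k,
    eps i j k • wedge (wedge ((Ω i).curryLeft v) ((Ω j).curryLeft w)) (Ω k)

/-- The matrix of `β` in the basis `b`: `β(b_p, b_q) = B_pq · b.det`. -/
def betaMatrix (b : Module.Basis (Fin 4) ℝ V) (Ω : Fin 3 → V [⋀^Fin 2]→ₗ[ℝ] ℝ) :
    Matrix (Fin 4) (Fin 4) ℝ :=
  Matrix.of fun p q => beta Ω (b p) (b q) b

/-- The volume form `μ` induced by the triple. If `μ = c · b.det` and `g = B / c`, then `μ` is
a volume form of `g` when `det g = c²`, that is `c⁶ = det B`; the sign of `c` is the one for which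
`g` is positive. See `eq_induced` for the characterization by `g ⊗ μ = β`. -/
def inducedVolume (b : Module.Basis (Fin 4) ℝ V) (Ω : Fin 3 → V [⋀^Fin 2]→ₗ[ℝ] ℝ) :
    V [⋀^Fin 4]→ₗ[ℝ] ℝ :=
  (Real.sign (betaMatrix b Ω).trace * |(betaMatrix b Ω).det| ^ (1 / 6 : ℝ)) • b.det

/-- The metric `g` induced by the triple, `g ⊗ μ = β`. -/
def inducedMetric (b : Module.Basis (Fin 4) ℝ V) (Ω : Fin 3 → V [⋀^Fin 2]→ₗ[ℝ] ℝ) (v w : V) : ℝ :=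
  beta Ω v w b / inducedVolume b Ω b

/-- `Q_ij = Ω_i ∧ Ω_j / (2 μ)`. -/
def inducedQ (b : Module.Basis (Fin 4) ℝ V) (Ω : Fin 3 → V [⋀^Fin 2]→ₗ[ℝ] ℝ) :
    Matrix (Fin 3) (Fin 3) ℝ :=
  Matrix.of fun i j => wedge (Ω i) (Ω j) b / (2 * inducedVolume b Ω b)

/-- If `h` is a positive definite metric with volume form `ν` (of either orientation) and
`β = h ⊗ ν`, then `ν` and `h` are the induced volume form and metric. -/
theorem eq_induced (b : Module.Basis (Fin 4) ℝ V) (Ω : Fin 3 → V [⋀^Fin 2]→ₗ[ℝ] ℝ)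
    (h : V → V → ℝ) (ν : V [⋀^Fin 4]→ₗ[ℝ] ℝ) (hpos : (gram b h).PosDef)
    (hvol : ν b ^ 2 = (gram b h).det) (hβ : ∀ v w, beta Ω v w = h v w • ν) :
    ν = inducedVolume b Ω ∧ h = inducedMetric b Ω := by
  have hB : betaMatrix b Ω = ν b • gram b h := by
    ext p q
    simp [betaMatrix, gram, hβ, mul_comm]
  have htr : 0 < (gram b h).trace := hpos.trace_pos
  have hdet : 0 < (gram b h).det := hpos.det_pos
  have hne : ν b ≠ 0 := by
    intro h0
    rw [h0] at hvol
    norm_num at hvol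
    linarith
  have hν : ν = ν b • b.det := by
    refine Module.Basis.ext_alternating b fun v hv => ?_
    have := AlternatingMap.eq_smul_basis_det b ν
    exact congrArg (fun f => f (fun i => b (v i))) this
  have hc : Real.sign (betaMatrix b Ω).trace * |(betaMatrix b Ω).det| ^ (1 / 6 : ℝ) = ν b := by
    have h6 : |(betaMatrix b Ω).det| = |ν b| ^ (6 : ℕ) := by
      rw [hB, Matrix.det_smul, ← hvol, abs_mul, abs_pow, abs_pow]
      simp only [Fintype.card_fin]
      ring
    have hr : |(betaMatrix b Ω).det| ^ (1 / 6 : ℝ) = |ν b| := by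
      rw [h6, one_div]
      exact_mod_cast Real.pow_rpow_inv_natCast (abs_nonneg (ν b)) (by norm_num : (6 : ℕ) ≠ 0)
    rw [hr, hB, Matrix.trace_smul, smul_eq_mul]
    rcases lt_or_gt_of_ne hne with hlt | hgt
    · rw [Real.sign_of_neg (mul_neg_of_neg_of_pos hlt htr), abs_of_neg hlt]
      ring
    · rw [Real.sign_of_pos (mul_pos hgt htr), abs_of_pos hgt]
      ring
  have h1 : ν = inducedVolume b Ω := by
    rw [inducedVolume, hc]
    exact hν
  refine ⟨h1, ?_⟩
  funext v w
  rw [inducedMetric, ← h1, hβ]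
  simp [hne]

/-- The volume form of the metric `g` that is positive for the orientation `o`. -/
def orientedVolume (o : Orientation ℝ V (Fin 4)) (b : Module.Basis (Fin 4) ℝ V)
    (g : V → V → ℝ) : V [⋀^Fin 4]→ₗ[ℝ] ℝ :=
  open Classical in
  ((if b.orientation = o then 1 else -1) * √(gram b g).det) • b.det

/-- The operators `E_i(α) = -*(α ∧ Ω_i)` on linear forms; `*` is the Hodge star of the
induced metric and volume form. -/
def opE (b : Module.Basis (Fin 4) ℝ V) (Ω : Fin 3 → V [⋀^Fin 2]→ₗ[ℝ] ℝ) (i : Fin 3)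
    (α : V →ₗ[ℝ] ℝ) : V →ₗ[ℝ] ℝ :=
  -linearForm (hodgeStar (k := 3) (l := 1) b (inducedMetric b Ω) (inducedVolume b Ω)
    (wedge (oneForm α) (Ω i)))

/-- The 2-covectors that are self-dual for `g` and the orientation `o`. -/
def IsSelfDual (o : Orientation ℝ V (Fin 4)) (b : Module.Basis (Fin 4) ℝ V) (g : V → V → ℝ)
    (η : V [⋀^Fin 2]→ₗ[ℝ] ℝ) : Prop :=
  hodgeStar (k := 2) (l := 2) b g (orientedVolume o b g) η = η

end Pointwise

/-! ### Differential forms on a 4-manifold -/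

/-- The model space. -/
abbrev E4 : Type := EuclideanSpace ℝ (Fin 4)

section Manifold

variable {X : Type*} [TopologicalSpace X] [ChartedSpace E4 X]

/-- A differential `k`-form (no regularity required). -/
abbrev Form (X : Type*) [TopologicalSpace X] [ChartedSpace E4 X] (k : ℕ) : Type _ :=
  (x : X) → TangentSpace (𝓡 4) x [⋀^Fin k]→L[ℝ] ℝ

/-- The expression of a form in the preferred chart at `x₀`: its pullback under the inverse of
the chart. -/
def Form.inChart {k : ℕ} (η : Form X k) (x₀ : X) (y : E4) : E4 [⋀^Fin k]→L[ℝ] ℝ :=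
  (η ((extChartAt (𝓡 4) x₀).symm y)).compContinuousLinearMap
    (mfderiv 𝓘(ℝ, E4) (𝓡 4) (extChartAt (𝓡 4) x₀).symm y)

/-- Smoothness of a form. -/
def Form.IsSmooth {k : ℕ} (η : Form X k) : Prop :=
  ∀ x₀ : X, ContDiffOn ℝ ∞ (η.inChart x₀) (extChartAt (𝓡 4) x₀).target

/-- Closedness of a form: `dη = 0` in the charts. -/
def Form.IsClosed {k : ℕ} (η : Form X k) : Prop :=
  ∀ x₀ : X, ∀ y ∈ (extChartAt (𝓡 4) x₀).target, extDeriv (η.inChart x₀) y = 0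

/-- The triple of 2-covectors at the point `x`. -/
def tripleAt (Ω : Fin 3 → Form X 2) (x : X) :
    Fin 3 → TangentSpace (𝓡 4) x [⋀^Fin 2]→ₗ[ℝ] ℝ :=
  fun i => (Ω i x).toAlternatingMap

/-- A hypersymplectic structure on the 4-manifold with the orientations `o x` of its tangent
spaces: a triple of smooth closed 2-forms that at each point is linearly independent and spans
a subspace of `Λ²` on which the wedge product is positive definite. (A 3-dimensional positive
definite subspace is maximal, because the wedge product has signature `(3, 3)`. That the
orientations vary continuously is a consequence.) -/
structure IsHypersymplectic (o : (x : X) → Orientation ℝ (TangentSpace (𝓡 4) x) (Fin 4))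
    (Ω : Fin 3 → Form X 2) : Prop where
  smooth : ∀ i, (Ω i).IsSmooth
  closed : ∀ i, (Ω i).IsClosed
  posDef : ∀ x, ∀ e : Module.Basis (Fin 4) ℝ (TangentSpace (𝓡 4) x), e.orientation = o x →
    (Matrix.of fun i j => wedge (tripleAt Ω x i) (tripleAt Ω x j) e).PosDef

/-- The standard basis of a tangent space; the notions below do not depend on it. -/
def frame (x : X) : Module.Basis (Fin 4) ℝ (TangentSpace (𝓡 4) x) :=
  (EuclideanSpace.basisFun (Fin 4) ℝ).toBasis

/-- The Riemannian metric of the triple. -/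
def metric (Ω : Fin 3 → Form X 2) (x : X) (v w : TangentSpace (𝓡 4) x) : ℝ :=
  inducedMetric (frame x) (tripleAt Ω x) v w

/-- The matrix valued function `Q` of the triple. -/
def Q (Ω : Fin 3 → Form X 2) (x : X) : Matrix (Fin 3) (Fin 3) ℝ :=
  inducedQ (frame x) (tripleAt Ω x)

/-- The 1-form `dQ_ij`. -/
def dQ (Ω : Fin 3 → Form X 2) (i j : Fin 3) (x : X) : TangentSpace (𝓡 4) x →ₗ[ℝ] ℝ :=
  (mvfderiv (𝓡 4) (fun y => Q Ω y i j) x).toLinearMap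

/-- The matrix of 1-forms `dQ Q⁻¹`. -/
def dQQinv (Ω : Fin 3 → Form X 2) (i j : Fin 3) (x : X) : TangentSpace (𝓡 4) x →ₗ[ℝ] ℝ :=
  ∑ k, (Q Ω x)⁻¹ k j • dQ Ω i k x

/-- The torsion 1-forms `τ_i = -∑ E_k (dQ Q⁻¹)_ik`. -/
def tau (Ω : Fin 3 → Form X 2) (i : Fin 3) (x : X) : TangentSpace (𝓡 4) x →ₗ[ℝ] ℝ :=
  -∑ k, opE (frame x) (tripleAt Ω x) k (dQQinv Ω i k x)

/-- `X_ij = (1/2) ∑ ε_ijk (Q⁻¹)_kl τ_l`. -/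
def matX (Ω : Fin 3 → Form X 2) (i j : Fin 3) (x : X) : TangentSpace (𝓡 4) x →ₗ[ℝ] ℝ :=
  (1 / 2 : ℝ) • ∑ k, ∑ l, (eps i j k * (Q Ω x)⁻¹ k l) • tau Ω l x

/-- The vector field `V` is differentiable at `x`, as a section of the tangent bundle. -/
def DiffAt [IsManifold (𝓡 4) ∞ X] (V : (y : X) → TangentSpace (𝓡 4) y) (x : X) : Prop :=
  MDifferentiableAt (𝓡 4) ((𝓡 4).prod 𝓘(ℝ, E4)) (fun y => Bundle.TotalSpace.mk' E4 y (V y)) x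

/-- `∇` is the Levi-Civita connection of `g`: it is torsion free and metric,
 `u(g(V, W)) = g(∇_u V, W) + g(V, ∇_u W)`. In Mathlib's convention `cov V x u` is
`∇_u V` at `x`. -/
structure IsLeviCivita [IsManifold (𝓡 4) ∞ X]
    (g : (x : X) → TangentSpace (𝓡 4) x → TangentSpace (𝓡 4) x → ℝ)
    (cov : CovariantDerivative (𝓡 4) E4 (TangentSpace (𝓡 4) : X → Type _)) : Prop where
  torsionFree : cov.torsion = 0
  metric : ∀ (x : X) (V W : (y : X) → TangentSpace (𝓡 4) y),
    DiffAt V x → DiffAt W x → ∀ u : TangentSpace (𝓡 4) x,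
      mvfderiv (𝓡 4) (fun y => g y (V y) (W y)) x u =
        g x (cov V x u) (W x) + g x (V x) (cov W x u)

/-- The induced covariant derivative of a 2-form:
`(∇_u η)(V, W) = u(η(V, W)) - η(∇_u V, W) - η(V, ∇_u W)`. -/
def covTwoForm [IsManifold (𝓡 4) ∞ X]
    (cov : CovariantDerivative (𝓡 4) E4 (TangentSpace (𝓡 4) : X → Type _))
    (η : Form X 2) (x : X) (u : TangentSpace (𝓡 4) x)
    (V W : (y : X) → TangentSpace (𝓡 4) y) : ℝ :=
  mvfderiv (𝓡 4) (fun y => η y ![V y, W y]) x u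
    - η x ![cov V x u, W x] - η x ![V x, cov W x u]

/-- `a` is the matrix of the connection in the framing `Ω`: `∇Ω_i = ∑ a_ij ⊗ Ω_j`. -/
def IsConnectionMatrix [IsManifold (𝓡 4) ∞ X]
    (cov : CovariantDerivative (𝓡 4) E4 (TangentSpace (𝓡 4) : X → Type _))
    (Ω : Fin 3 → Form X 2)
    (a : Fin 3 → Fin 3 → (x : X) → TangentSpace (𝓡 4) x →ₗ[ℝ] ℝ) : Prop :=
  ∀ (i : Fin 3) (x : X) (u : TangentSpace (𝓡 4) x) (V W : (y : X) → TangentSpace (𝓡 4) y),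
    DiffAt V x → DiffAt W x →
      covTwoForm cov (Ω i) x u V W = ∑ j, a i j x u * Ω j x ![V x, W x]

/-- At every point the triple is a basis of the self-dual 2-covectors of its metric. -/
def IsFramingOfSelfDual (o : (x : X) → Orientation ℝ (TangentSpace (𝓡 4) x) (Fin 4))
    (Ω : Fin 3 → Form X 2) : Prop :=
  ∀ x, LinearIndependent ℝ (tripleAt Ω x) ∧
    ∀ η : TangentSpace (𝓡 4) x [⋀^Fin 2]→ₗ[ℝ] ℝ,
      η ∈ Submodule.span ℝ (Set.range (tripleAt Ω x)) ↔
        IsSelfDual (o x) (frame x) (metric Ω x) η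

end Manifold

end Hypersymplectic

end

open scoped Manifold ContDiff

noncomputable section

open scoped Topology

namespace Hypersymplectic

/-! At one point everything is linear algebra. A positive definite triple has a normal frame
(`IsNormalFrame`, `exists_isNormalFrame`): a basis `e` with `Ω_i = ∑ A_ij σ_j`, where `σ` is the
standard self-dual triple and `det A = ±1`. There `β` is the Euclidean product of `e` times `det A ·
e.det`, so `eq_induced` makes `e` orthonormal for `g`, gives `μ = det A · e.det` and `Q = det A · A
Aᵀ`, and identifies the span of the triple with the span of `σ`, which is `Λ⁺`. Two identities
follow at every point and in every basis: `(det Q)² = 1`, and the Clifford relation `W_i G⁻¹ W_j +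
W_j G⁻¹ W_i = -2 det Q Q_ij G` between the matrices `W_i` of the forms and `G` of the metric.

Now let `K_i(u) = ∇_u Ω_i`. Differentiating the Clifford relation with `∇g = 0` gives a linearised
relation with `dQ` on the right. Closedness together with vanishing torsion gives `K_i(u; v, w) +
cyclic = 0`. Since `(det Q)² = 1`, the differential of `det Q` vanishes, which is a trace condition
on `dQ`. These three facts determine `K` (`eq_sum_stdForm`): for the standard triple the linearised
relation forces `K_i` to be self-dual and fixes the symmetric part of its coefficients as half the
derivative of the Gram matrix, and the cyclic identity is then a system of twelve linear equations
for the twelve antisymmetric coefficients, solved by the torsion forms. `frameConnection_eq` carries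
the answer from `σ` to `Ω`, where it becomes `½ dQ Q⁻¹ + X Q⁻¹`.

The derivatives are computed in the chart at `x`, in a constant basis that is normal only at `x`.
The Christoffel terms cancel from the differentiated relation (`flatCov_eq`), so neither geodesic
coordinates nor a smooth normal frame is needed; normal frames at nearby points serve only to know
that the two identities hold there. Tensoriality (`covTwoForm_eq_coordField`) reduces arbitrary
vector fields to coordinate fields, and uniqueness of the connection matrix is linear independence
of the triple. -/

/-! ### Signed sums over small symmetric groups -/

theorem sum_perm_fin_succ {n : ℕ} {M : Type*} [AddCommMonoid M]
    (f : Equiv.Perm (Fin (n + 1)) → M) :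
    ∑ σ, f σ = ∑ i, ∑ τ : Equiv.Perm (Fin n), f (Equiv.Perm.decomposeFin.symm (i, τ)) := by
  rw [← Equiv.sum_comp Equiv.Perm.decomposeFin.symm f, Fintype.sum_prod_type]

theorem sum_perm_two (g : Fin 2 → Fin 2 → ℝ) :
    ∑ σ : Equiv.Perm (Fin 2), (Equiv.Perm.sign σ : ℝ) * g (σ 0) (σ 1) = g 0 1 - g 1 0 := by
  have h : (Finset.univ : Finset (Equiv.Perm (Fin 2))) = {1, Equiv.swap 0 1} := by decide
  rw [h, Finset.sum_pair (by decide)]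
  simp
  ring

/-- Expansion by the value at `0`: `decomposeFin` writes a permutation as the transposition of `0`
and `i` after a shifted permutation of the remaining indices, so each `i ≠ 0` contributes one sign
change. -/
theorem sum_perm_three (g : Fin 3 → Fin 3 → Fin 3 → ℝ) :
    ∑ σ : Equiv.Perm (Fin 3), (Equiv.Perm.sign σ : ℝ) * g (σ 0) (σ 1) (σ 2) =
      g 0 1 2 - g 0 2 1 - g 1 0 2 + g 1 2 0 + g 2 0 1 - g 2 1 0 := by
  have e1 : ∀ (i : Fin 3) (τ : Equiv.Perm (Fin 2)), Equiv.Perm.decomposeFin.symm (i, τ) 1 =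
     Equiv.swap 0 i (τ 0).succ := fun i τ => Equiv.Perm.decomposeFin_symm_apply_succ τ i 0
  have e2 : ∀ (i : Fin 3) (τ : Equiv.Perm (Fin 2)), Equiv.Perm.decomposeFin.symm (i, τ) 2 =
     Equiv.swap 0 i (τ 1).succ := fun i τ => Equiv.Perm.decomposeFin_symm_apply_succ τ i 1
  rw [sum_perm_fin_succ]
  simp only [Equiv.Perm.decomposeFin.symm_sign, Equiv.Perm.decomposeFin_symm_apply_zero, e1, e2,
    Fin.sum_univ_three, if_true, one_mul]
  have a := sum_perm_two fun j k => g 0 (Equiv.swap 0 0 j.succ) (Equiv.swap 0 0 k.succ)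
  have b := sum_perm_two fun j k => g 1 (Equiv.swap 0 1 j.succ) (Equiv.swap 0 1 k.succ)
  have c := sum_perm_two fun j k => g 2 (Equiv.swap 0 2 j.succ) (Equiv.swap 0 2 k.succ)
  simp only [show (1 : Fin 3) ≠ 0 by decide, show (2 : Fin 3) ≠ 0 by decide, if_false]
  simp only [Units.val_neg, Int.cast_neg, neg_mul, one_mul, Finset.sum_neg_distrib]
  rw [a, b, c]
  simp [Equiv.swap_apply_def]
  ring

theorem sum_perm_four (g : Fin 4 → Fin 4 → Fin 4 → Fin 4 → ℝ) :
    ∑ σ : Equiv.Perm (Fin 4), (Equiv.Perm.sign σ : ℝ) * g (σ 0) (σ 1) (σ 2) (σ 3) =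
      g 0 1 2 3 - g 0 1 3 2 - g 0 2 1 3 + g 0 2 3 1 + g 0 3 1 2 - g 0 3 2 1
      - g 1 0 2 3 + g 1 0 3 2 + g 1 2 0 3 - g 1 2 3 0 - g 1 3 0 2 + g 1 3 2 0
      + g 2 0 1 3 - g 2 0 3 1 - g 2 1 0 3 + g 2 1 3 0 + g 2 3 0 1 - g 2 3 1 0
      - g 3 0 1 2 + g 3 0 2 1 + g 3 1 0 2 - g 3 1 2 0 - g 3 2 0 1 + g 3 2 1 0 := by
  have e1 : ∀ (i : Fin 4) (τ : Equiv.Perm (Fin 3)), Equiv.Perm.decomposeFin.symm (i, τ) 1 =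
     Equiv.swap 0 i (τ 0).succ := fun i τ => Equiv.Perm.decomposeFin_symm_apply_succ τ i 0
  have e2 : ∀ (i : Fin 4) (τ : Equiv.Perm (Fin 3)), Equiv.Perm.decomposeFin.symm (i, τ) 2 =
     Equiv.swap 0 i (τ 1).succ := fun i τ => Equiv.Perm.decomposeFin_symm_apply_succ τ i 1
  have e3 : ∀ (i : Fin 4) (τ : Equiv.Perm (Fin 3)), Equiv.Perm.decomposeFin.symm (i, τ) 3 =
     Equiv.swap 0 i (τ 2).succ := fun i τ => Equiv.Perm.decomposeFin_symm_apply_succ τ i 2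
  rw [sum_perm_fin_succ]
  simp only [Equiv.Perm.decomposeFin.symm_sign, Equiv.Perm.decomposeFin_symm_apply_zero, e1, e2,
    e3, Fin.sum_univ_four, if_true, one_mul]
  have a := fun i : Fin 4 => sum_perm_three fun j k l =>
    g i (Equiv.swap 0 i j.succ) (Equiv.swap 0 i k.succ) (Equiv.swap 0 i l.succ)
  simp only [show (1 : Fin 4) ≠ 0 by decide, show (2 : Fin 4) ≠ 0 by decide,
    show (3 : Fin 4) ≠ 0 by decide, if_false]
  simp only [Units.val_neg, Int.cast_neg, neg_mul, one_mul, Finset.sum_neg_distrib]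
  rw [a 0, a 1, a 2, a 3]
  simp [Equiv.swap_apply_def]
  ring

/-! ### Explicit wedge products in low degree -/

section WedgeFormulas

variable {V : Type*} [AddCommGroup V] [Module ℝ V]

/-- The shuffle sum is a sum over cosets of `S_k × S_l`. Each coset is counted `k! l!` times in the
alternatization of the plain tensor product, which is a sum over all permutations and can be
expanded. -/
theorem factorial_mul_wedge_apply {k l : ℕ} (α : V [⋀^Fin k]→ₗ[ℝ] ℝ) (β : V [⋀^Fin l]→ₗ[ℝ] ℝ)
    (v : Fin (k + l) → V) :
    ((k.factorial * l.factorial : ℕ) : ℝ) * wedge α β v =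
      ∑ σ : Equiv.Perm (Fin (k + l)), (Equiv.Perm.sign σ : ℝ) *
        (α (fun i => v (σ (Fin.castAdd l i))) * β (fun i => v (σ (Fin.natAdd k i)))) := by
  have h := congrArg (fun F => LinearMap.mul' ℝ ℝ (F (fun i => v (finSumFinEquiv i))))
    (MultilinearMap.domCoprod_alternization_eq α β)
  simp only [Fintype.card_fin] at h
  rw [← nsmul_eq_mul]
  have h2 : LinearMap.mul' ℝ ℝ (((k.factorial * l.factorial) • α.domCoprod β)
      (fun i => v (finSumFinEquiv i))) = (k.factorial * l.factorial) • wedge α β v := by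
    rw [wedge]
    simp only [AlternatingMap.smul_apply, map_nsmul]
    rfl
  rw [← h2, ← h, MultilinearMap.alternatization_apply, map_sum]
  refine Fintype.sum_equiv (finSumFinEquiv.permCongr) _ _ fun σ => ?_
  rw [Units.smul_def, map_zsmul, zsmul_eq_mul]
  simp [MultilinearMap.domDomCongr_apply]

theorem two_swap (α : V [⋀^Fin 2]→ₗ[ℝ] ℝ) (v w : V) : α ![v, w] = - α ![w, v] := by
  have := α.map_swap ![w, v] (i := 0) (j := 1) (by decide)
  rw [← this]; congr 1; ext i; fin_cases i <;> rfl

theorem fin_one_fun_eq {α : Type*} (f : Fin 1 → α) : f = ![f 0] := by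
  ext i; fin_cases i; rfl

theorem fin_two_fun_eq {α : Type*} (f : Fin 2 → α) : f = ![f 0, f 1] := by
  ext i; fin_cases i <;> rfl

theorem wedge_one_one (α β : V [⋀^Fin 1]→ₗ[ℝ] ℝ) (v : Fin 2 → V) :
    wedge α β v = α ![v 0] * β ![v 1] - α ![v 1] * β ![v 0] := by
  have h := factorial_mul_wedge_apply α β v
  have h3 := sum_perm_two fun a b => α ![v a] * β ![v b]
  rw [← h3]
  simp only [Nat.factorial_one, mul_one, Nat.cast_one, one_mul] at h
  rw [h]
  refine Finset.sum_congr rfl fun σ _ => ?_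
  rw [fin_one_fun_eq (fun i => v (σ (Fin.castAdd 1 i))),
    fin_one_fun_eq (fun i => v (σ (Fin.natAdd 1 i)))]
  rfl

theorem wedge_one_two (α : V [⋀^Fin 1]→ₗ[ℝ] ℝ) (β : V [⋀^Fin 2]→ₗ[ℝ] ℝ) (v : Fin 3 → V) :
    wedge α β v = α ![v 0] * β ![v 1, v 2] - α ![v 1] * β ![v 0, v 2]
      + α ![v 2] * β ![v 0, v 1] := by
  have h := factorial_mul_wedge_apply α β v
  have h3 := sum_perm_three fun a b c => α ![v a] * β ![v b, v c]
  have h4 : ((Nat.factorial 1 * Nat.factorial 2 : ℕ) : ℝ) = 2 := by norm_num [Nat.factorial]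
  rw [h4] at h
  have h5 := h.trans <| (show _ = _ by
    refine Finset.sum_congr rfl fun σ _ => ?_
    rw [fin_one_fun_eq (fun i => v (σ (Fin.castAdd 2 i))),
      fin_two_fun_eq (fun i => v (σ (Fin.natAdd 1 i)))]
    rfl).trans h3
  rw [two_swap β (v 2) (v 1), two_swap β (v 2) (v 0), two_swap β (v 1) (v 0)] at h5
  linarith

theorem wedge_two_two (α β : V [⋀^Fin 2]→ₗ[ℝ] ℝ) (v : Fin 4 → V) :
    wedge α β v = α ![v 0, v 1] * β ![v 2, v 3] - α ![v 0, v 2] * β ![v 1, v 3]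
      + α ![v 0, v 3] * β ![v 1, v 2] + α ![v 1, v 2] * β ![v 0, v 3]
      - α ![v 1, v 3] * β ![v 0, v 2] + α ![v 2, v 3] * β ![v 0, v 1] := by
  have h := factorial_mul_wedge_apply α β v
  have h3 := sum_perm_four fun a b c d => α ![v a, v b] * β ![v c, v d]
  have h4 : ((Nat.factorial 2 * Nat.factorial 2 : ℕ) : ℝ) = 4 := by norm_num [Nat.factorial]
  rw [h4] at h
  have h5 := h.trans <| (show _ = _ by
    refine Finset.sum_congr rfl fun σ _ => ?_
    rw [fin_two_fun_eq (fun i => v (σ (Fin.castAdd 2 i))),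
      fin_two_fun_eq (fun i => v (σ (Fin.natAdd 2 i)))]
    rfl).trans h3
  rw [two_swap β (v 2) (v 1), two_swap β (v 2) (v 0), two_swap β (v 1) (v 0),
    two_swap β (v 3) (v 0), two_swap β (v 3) (v 1), two_swap β (v 3) (v 2),
    two_swap α (v 2) (v 1), two_swap α (v 2) (v 0), two_swap α (v 1) (v 0),
    two_swap α (v 3) (v 0), two_swap α (v 3) (v 1), two_swap α (v 3) (v 2)] at h5
  linarith

end WedgeFormulas

/-! ### The Hodge star in an orthonormal basis -/

section HodgeStar

variable {V : Type*} [AddCommGroup V] [Module ℝ V]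

/-- The hypothesis says that `e` is orthonormal. The inverse Gram matrix is then `C Cᵀ`, with `C`
expressing `e` in `b`, and the two factors `C` turn the arguments `b` into `e`. This frees the Hodge
star from the auxiliary basis. -/
theorem sum_prod_gram_inv {n k : ℕ} (b e : Module.Basis (Fin n) ℝ V) (g : V → V → ℝ)
    (hg : ∀ v w, g v w = ∑ r, e.repr v r * e.repr w r)
    (F G : MultilinearMap ℝ (fun _ : Fin k => V) ℝ) :
    ∑ p : Fin k → Fin n, ∑ q : Fin k → Fin n,
        ((∏ i, (gram b g)⁻¹ (p i) (q i)) * F (b ∘ q)) * G (b ∘ p) =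
      ∑ r : Fin k → Fin n, F (e ∘ r) * G (e ∘ r) := by
  set C := b.toMatrix e with hC
  have hgram : gram b g = (e.toMatrix b).transpose * e.toMatrix b := by
    ext p q
    simp [gram, hg, Matrix.mul_apply, Module.Basis.toMatrix_apply]
  have hinv : (gram b g)⁻¹ = C * C.transpose := by
    refine Matrix.inv_eq_right_inv ?_
    rw [hgram, Matrix.mul_assoc, ← Matrix.mul_assoc (e.toMatrix b),
      Module.Basis.toMatrix_mul_toMatrix_flip, Matrix.one_mul, ← Matrix.transpose_mul,
      Module.Basis.toMatrix_mul_toMatrix_flip, Matrix.transpose_one]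
  have hexp : ∀ (H : MultilinearMap ℝ (fun _ : Fin k => V) ℝ) (r : Fin k → Fin n),
      H (e ∘ r) = ∑ p : Fin k → Fin n, (∏ i, C (p i) (r i)) * H (b ∘ p) := by
    intro H r
    have : (e ∘ r : Fin k → V) = fun i => ∑ p, C p (r i) • b p := by
      ext i
      simp [hC, Module.Basis.toMatrix_apply, b.sum_repr]
    rw [this, H.map_sum]
    refine Finset.sum_congr rfl fun p _ => ?_
    rw [H.map_smul_univ]
    rfl
  simp_rw [hexp, hinv, Matrix.mul_apply, Matrix.transpose_apply, Finset.prod_univ_sum,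
    Fintype.piFinset_univ, Finset.sum_mul, Finset.mul_sum, Finset.prod_mul_distrib]
  rw [Finset.sum_comm]
  symm
  rw [Finset.sum_comm]
  refine Finset.sum_congr rfl fun q _ => ?_
  rw [Finset.sum_comm]
  refine Finset.sum_congr rfl fun p _ => ?_
  refine Finset.sum_congr rfl fun r _ => ?_
  ring

theorem contract_two_apply (ν : V [⋀^Fin 4]→ₗ[ℝ] ℝ) (w : Fin 2 → V) (v : Fin 2 → V) :
    contract (l := 2) 2 ν w v = ν ![w 0, w 1, v 0, v 1] := by
  change ν _ = ν _
  congr 1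
  ext i
  fin_cases i <;> rfl

theorem contract_three_apply (ν : V [⋀^Fin 4]→ₗ[ℝ] ℝ) (w : Fin 3 → V) (v : Fin 1 → V) :
    contract (l := 1) 3 ν w v = ν ![w 0, w 1, w 2, v 0] := by
  change ν _ = ν _
  congr 1
  ext i
  fin_cases i <;> rfl

/-- Insertion of vectors into the last `l` slots, leaving a multilinear map in the first `k`. -/
def insertLast {k l : ℕ} (ν : V [⋀^Fin (k + l)]→ₗ[ℝ] ℝ) (v : Fin l → V) :
    MultilinearMap ℝ (fun _ : Fin k => V) ℝ :=
  (LinearMap.compMultilinearMap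
    (M₂ := MultilinearMap ℝ (fun _ : Fin l => V) ℝ)
    { toFun := fun f => f v
      map_add' := fun _ _ => rfl
      map_smul' := fun _ _ => rfl }
    (MultilinearMap.currySum (ν.toMultilinearMap.domDomCongr finSumFinEquiv.symm)))

theorem insertLast_two_apply (ν : V [⋀^Fin 4]→ₗ[ℝ] ℝ) (v w : Fin 2 → V) :
    insertLast (k := 2) (l := 2) ν v w = ν ![w 0, w 1, v 0, v 1] := by
  change ν _ = ν _
  congr 1
  ext i
  fin_cases i <;> rfl

theorem insertLast_three_apply (ν : V [⋀^Fin 4]→ₗ[ℝ] ℝ) (v : Fin 1 → V) (w : Fin 3 → V) :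
    insertLast (k := 3) (l := 1) ν v w = ν ![w 0, w 1, w 2, v 0] := by
  change ν _ = ν _
  congr 1
  ext i
  fin_cases i <;> rfl

/-- The sign of `(i, j, k, l)` as a permutation of the four indices, `0` if two agree. -/
def eps₄ (i j k l : Fin 4) : ℤ :=
  ((j : ℤ) - i) * ((k : ℤ) - i) * ((l : ℤ) - i) * ((k : ℤ) - j) * ((l : ℤ) - j) * ((l : ℤ) - k) / 12

/-- The Vandermonde product of `0, 1, 2, 3` equals `12`, so the integer division is exact on
permutations. -/
theorem sign_eq_eps₄ : ∀ σ : Equiv.Perm (Fin 4),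
    (Equiv.Perm.sign σ : ℤ) = eps₄ (σ 0) (σ 1) (σ 2) (σ 3) := by
  decide

theorem eps₄_eq_zero : ∀ r : Fin 4 → Fin 4, (∃ i j, r i = r j ∧ i ≠ j) →
    eps₄ (r 0) (r 1) (r 2) (r 3) = 0 := by
  rintro r ⟨i, j, hr, hij⟩
  unfold eps₄
  fin_cases i <;> fin_cases j <;> simp at hr hij <;> simp [hr]

theorem map_basis_four (ν : V [⋀^Fin 4]→ₗ[ℝ] ℝ) (e : Fin 4 → V) (a b c d : Fin 4) :
    ν ![e a, e b, e c, e d] = eps₄ a b c d * ν e := by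
  have hr : (![e a, e b, e c, e d] : Fin 4 → V) = fun i => e (![a, b, c, d] i) := by
    ext i; fin_cases i <;> rfl
  by_cases h : Function.Injective ![a, b, c, d]
  · have hb : Function.Bijective ![a, b, c, d] := Finite.injective_iff_bijective.mp h
    have h1 := ν.map_perm e (Equiv.ofBijective _ hb)
    have h2 := sign_eq_eps₄ (Equiv.ofBijective _ hb)
    simp only [Equiv.ofBijective_apply] at h2
    rw [hr]
    change ν (e ∘ Equiv.ofBijective _ hb) = _
    rw [h1, Units.smul_def, h2, zsmul_eq_mul]
    rfl
  · obtain ⟨i, j, h1, h2⟩ : ∃ i j, ![a, b, c, d] i = ![a, b, c, d] j ∧ i ≠ j := by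
      simpa [Function.Injective] using h
    have h3 := eps₄_eq_zero _ ⟨i, j, h1, h2⟩
    have h4 : eps₄ a b c d = 0 := h3
    rw [hr, ν.map_eq_zero_of_eq (fun i => e (![a, b, c, d] i)) (congrArg e h1) h2, h4,
      Int.cast_zero, zero_mul]

theorem sum_fin_two_fun {n : ℕ} (f : (Fin 2 → Fin n) → ℝ) :
    ∑ r, f r = ∑ a, ∑ b, f ![a, b] := by
  rw [← Equiv.sum_comp (Fin.consEquiv fun _ => Fin n), Fintype.sum_prod_type]
  refine Finset.sum_congr rfl fun a _ => ?_
  rw [← Equiv.sum_comp (Equiv.funUnique (Fin 1) (Fin n)).symm]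
  refine Finset.sum_congr rfl fun b _ => ?_
  congr 1
  ext i; fin_cases i <;> rfl

theorem sum_fin_three_fun {n : ℕ} (f : (Fin 3 → Fin n) → ℝ) :
    ∑ r, f r = ∑ a, ∑ b, ∑ c, f ![a, b, c] := by
  rw [← Equiv.sum_comp (Fin.consEquiv fun _ => Fin n), Fintype.sum_prod_type]
  refine Finset.sum_congr rfl fun a _ => ?_
  rw [sum_fin_two_fun]
  rfl

theorem alternating_sum_apply {k : ℕ} {ι : Type*} (s : Finset ι) (f : ι → V [⋀^Fin k]→ₗ[ℝ] ℝ)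
    (v : Fin k → V) : (∑ i ∈ s, f i) v = ∑ i ∈ s, f i v :=
  map_sum (⟨⟨fun F : V [⋀^Fin k]→ₗ[ℝ] ℝ => F v, rfl⟩, fun _ _ => rfl⟩ :
    (V [⋀^Fin k]→ₗ[ℝ] ℝ) →+ ℝ) f s

theorem hodgeStar_apply {k l : ℕ} (b : Module.Basis (Fin (l + k)) ℝ V) (g : V → V → ℝ)
    (ν : V [⋀^Fin (l + k)]→ₗ[ℝ] ℝ) (ψ : V [⋀^Fin k]→ₗ[ℝ] ℝ) (v : Fin l → V) :
    hodgeStar b g ν ψ v = 1 / (k.factorial : ℝ) * ∑ p : Fin k → Fin (l + k),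
      ∑ q : Fin k → Fin (l + k), ((∏ i, (gram b g)⁻¹ (p i) (q i)) * ψ (b ∘ q)) *
        contract k ν (b ∘ p) v := by
  simp only [hodgeStar, AlternatingMap.smul_apply, alternating_sum_apply, smul_eq_mul]

theorem hodgeStar_two_apply (b e : Module.Basis (Fin 4) ℝ V) (g : V → V → ℝ)
    (hg : ∀ v w, g v w = ∑ r, e.repr v r * e.repr w r) (ν : V [⋀^Fin 4]→ₗ[ℝ] ℝ)
    (ψ : V [⋀^Fin 2]→ₗ[ℝ] ℝ) (s t : Fin 4) :
    hodgeStar (k := 2) (l := 2) b g ν ψ ![e s, e t] =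
      1 / 2 * ∑ c, ∑ d, ψ ![e c, e d] * (eps₄ c d s t * ν e) := by
  have h := sum_prod_gram_inv b e g hg ψ.toMultilinearMap
    (insertLast (k := 2) (l := 2) ν ![e s, e t])
  simp only [insertLast_two_apply, AlternatingMap.coe_multilinearMap] at h
  rw [sum_fin_two_fun (n := 4) (fun r => ψ (e ∘ r) * _)] at h
  refine (hodgeStar_apply (k := 2) (l := 2) b g ν ψ _).trans ?_
  congr 1
  simp only [contract_two_apply]
  refine h.trans (Finset.sum_congr rfl fun c _ => Finset.sum_congr rfl fun d _ => ?_)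
  rw [← map_basis_four]
  congr 2
  exact fin_two_fun_eq _

theorem hodgeStar_three_apply (b e : Module.Basis (Fin 4) ℝ V) (g : V → V → ℝ)
    (hg : ∀ v w, g v w = ∑ r, e.repr v r * e.repr w r) (ν : V [⋀^Fin 4]→ₗ[ℝ] ℝ)
    (ψ : V [⋀^Fin 3]→ₗ[ℝ] ℝ) (t : Fin 4) :
    hodgeStar (k := 3) (l := 1) b g ν ψ ![e t] =
      1 / 6 * ∑ c, ∑ d, ∑ f, ψ ![e c, e d, e f] * (eps₄ c d f t * ν e) := by
  have h := sum_prod_gram_inv b e g hg ψ.toMultilinearMap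
    (insertLast (k := 3) (l := 1) ν ![e t])
  simp only [insertLast_three_apply, AlternatingMap.coe_multilinearMap] at h
  rw [sum_fin_three_fun (n := 4) (fun r => ψ (e ∘ r) * _)] at h
  refine (hodgeStar_apply (k := 3) (l := 1) b g ν ψ _).trans ?_
  rw [show ((Nat.factorial 3 : ℕ) : ℝ) = 6 by norm_num [Nat.factorial]]
  congr 1
  simp only [contract_three_apply]
  refine h.trans (Finset.sum_congr rfl fun c _ => Finset.sum_congr rfl fun d _ =>
    Finset.sum_congr rfl fun f _ => ?_)
  rw [← map_basis_four]
  congr 2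
  ext i; fin_cases i <;> rfl

end HodgeStar

/-! ### Normal frames and the induced structures in them -/

section NormalFrame

variable {V : Type*} [AddCommGroup V] [Module ℝ V]

/-- The matrices of the forms `e⁰¹ + e²³`, `e⁰² + e³¹` and `e⁰³ + e¹²`. -/
def stdForm : Fin 3 → Matrix (Fin 4) (Fin 4) ℝ :=
  ![!![0, 1, 0, 0; -1, 0, 0, 0; 0, 0, 0, 1; 0, 0, -1, 0],
    !![0, 0, 1, 0; 0, 0, 0, -1; -1, 0, 0, 0; 0, 1, 0, 0],
    !![0, 0, 0, 1; 0, 0, 1, 0; 0, -1, 0, 0; -1, 0, 0, 0]]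

/-- In the frame `e` the triple is a unimodular transform of the standard triple. -/
structure IsNormalFrame (Ω : Fin 3 → V [⋀^Fin 2]→ₗ[ℝ] ℝ) (e : Module.Basis (Fin 4) ℝ V)
    (A : Matrix (Fin 3) (Fin 3) ℝ) : Prop where
  det_sq : A.det ^ 2 = 1
  apply_basis : ∀ i p q, Ω i ![e p, e q] = ∑ j, A i j * stdForm j p q

theorem two_apply_eq_sum (η : V [⋀^Fin 2]→ₗ[ℝ] ℝ) (e : Module.Basis (Fin 4) ℝ V) (v w : V) :
    η ![v, w] = ∑ p, ∑ q, e.repr v p * e.repr w q * η ![e p, e q] := by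
  have h : (![v, w] : Fin 2 → V) = fun i => ∑ p, e.repr (![v, w] i) p • e p := by
    ext i; rw [e.sum_repr]
  rw [h, ← AlternatingMap.coe_multilinearMap, MultilinearMap.map_sum, sum_fin_two_fun]
  refine Finset.sum_congr rfl fun p _ => Finset.sum_congr rfl fun q _ => ?_
  rw [MultilinearMap.map_smul_univ, Fin.prod_univ_two, smul_eq_mul]
  congr 2
  ext i; fin_cases i <;> rfl

theorem four_eq_smul_det (e : Module.Basis (Fin 4) ℝ V) (ν : V [⋀^Fin 4]→ₗ[ℝ] ℝ) :
    ν = ν e • e.det :=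
  AlternatingMap.eq_smul_basis_det e ν

theorem beta_apply (Ω : Fin 3 → V [⋀^Fin 2]→ₗ[ℝ] ℝ) (v w : V) (x : Fin 4 → V) :
    beta Ω v w x = 1 / 6 * ∑ i, ∑ j, ∑ k, eps i j k *
      ((Ω i ![v, x 0] * Ω j ![w, x 1] - Ω i ![v, x 1] * Ω j ![w, x 0]) * Ω k ![x 2, x 3]
      - (Ω i ![v, x 0] * Ω j ![w, x 2] - Ω i ![v, x 2] * Ω j ![w, x 0]) * Ω k ![x 1, x 3]
      + (Ω i ![v, x 0] * Ω j ![w, x 3] - Ω i ![v, x 3] * Ω j ![w, x 0]) * Ω k ![x 1, x 2]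
      + (Ω i ![v, x 1] * Ω j ![w, x 2] - Ω i ![v, x 2] * Ω j ![w, x 1]) * Ω k ![x 0, x 3]
      - (Ω i ![v, x 1] * Ω j ![w, x 3] - Ω i ![v, x 3] * Ω j ![w, x 1]) * Ω k ![x 0, x 2]
      + (Ω i ![v, x 2] * Ω j ![w, x 3] - Ω i ![v, x 3] * Ω j ![w, x 2]) * Ω k ![x 0, x 1]) := by
  have hw : ∀ i j k, wedge (wedge ((Ω i).curryLeft v) ((Ω j).curryLeft w)) (Ω k) x = _ :=
    fun i j k => wedge_two_two (wedge ((Ω i).curryLeft v) ((Ω j).curryLeft w)) (Ω k) x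
  rw [beta, AlternatingMap.smul_apply, smul_eq_mul]
  congr 1
  simp only [alternating_sum_apply, AlternatingMap.smul_apply, smul_eq_mul]
  refine Finset.sum_congr rfl fun i _ => Finset.sum_congr rfl fun j _ =>
    Finset.sum_congr rfl fun k _ => ?_
  rw [hw]
  simp only [wedge_one_one]
  rfl

theorem linearForm_apply (α : V [⋀^Fin 1]→ₗ[ℝ] ℝ) (v : V) : linearForm α v = α ![v] := by
  change α _ = α _
  congr 1
  ext i; fin_cases i; rfl

namespace IsNormalFrame

variable {Ω : Fin 3 → V [⋀^Fin 2]→ₗ[ℝ] ℝ} {e : Module.Basis (Fin 4) ℝ V}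
  {A : Matrix (Fin 3) (Fin 3) ℝ}

theorem apply_right (h : IsNormalFrame Ω e A) (i : Fin 3) (v : V) (q : Fin 4) :
    Ω i ![v, e q] = ∑ p, e.repr v p * ∑ j, A i j * stdForm j p q := by
  rw [two_apply_eq_sum _ e]
  refine Finset.sum_congr rfl fun p _ => ?_
  simp [Finsupp.single_apply, h.apply_basis]

/-- `β` is cubic and alternating in the index of the triple, so replacing `σ` by `A σ` multiplies it
by `det A`. For `σ` itself it is the Euclidean product times `e.det`. -/
theorem beta_eq (h : IsNormalFrame Ω e A) (v w : V) :
    beta Ω v w = (∑ r, e.repr v r * e.repr w r) • (A.det • e.det) := by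
  rw [four_eq_smul_det e (beta Ω v w), smul_smul]
  congr 1
  rw [beta_apply]
  simp only [h.apply_right]
  generalize e.repr v = a
  generalize e.repr w = b
  simp [Fin.sum_univ_three, Fin.sum_univ_four, stdForm, eps, Matrix.det_fin_three]
  ring

theorem det_ne_zero (h : IsNormalFrame Ω e A) : A.det ≠ 0 := by
  intro h0
  have := h.det_sq
  simp [h0] at this

theorem isUnit_det (h : IsNormalFrame Ω e A) : IsUnit A.det := h.det_ne_zero.isUnit

theorem gram_eq (b e : Module.Basis (Fin 4) ℝ V) :
    gram b (fun v w => ∑ r, e.repr v r * e.repr w r) =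
      (e.toMatrix b).transpose * e.toMatrix b := by
  ext p q
  simp [gram, Matrix.mul_apply, Module.Basis.toMatrix_apply]

theorem posDef_gram (b e : Module.Basis (Fin 4) ℝ V) :
    (gram b (fun v w => ∑ r, e.repr v r * e.repr w r)).PosDef := by
  rw [gram_eq]
  have := Matrix.PosDef.conjTranspose_mul_self (e.toMatrix b) (by
    rw [Matrix.mulVec_injective_iff_isUnit]
    have := e.invertibleToMatrix b
    exact isUnit_of_invertible _)
  simpa using this

theorem induced_eq (h : IsNormalFrame Ω e A) (b : Module.Basis (Fin 4) ℝ V) :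
    inducedVolume b Ω = A.det • e.det ∧
      inducedMetric b Ω = fun v w => ∑ r, e.repr v r * e.repr w r := by
  have := eq_induced b Ω (fun v w => ∑ r, e.repr v r * e.repr w r) (A.det • e.det)
    (posDef_gram b e) (by
      rw [gram_eq, Matrix.det_mul, Matrix.det_transpose, AlternatingMap.smul_apply,
        Module.Basis.det_apply, smul_eq_mul, mul_pow, h.det_sq]
      ring) h.beta_eq
  exact ⟨this.1.symm, this.2.symm⟩

theorem wedge_eq (h : IsNormalFrame Ω e A) (i j : Fin 3) :
    wedge (Ω i) (Ω j) = (2 * (A * A.transpose) i j) • e.det := by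
  refine (four_eq_smul_det e (wedge (Ω i) (Ω j))).trans ?_
  congr 1
  refine (wedge_two_two (Ω i) (Ω j) e).trans ?_
  simp only [h.apply_basis]
  simp [Fin.sum_univ_three, stdForm, Matrix.mul_apply]
  ring

theorem inducedQ_eq (h : IsNormalFrame Ω e A) (b : Module.Basis (Fin 4) ℝ V) :
    inducedQ b Ω = A.det • (A * A.transpose) := by
  ext i j
  have hb : e.det b ≠ 0 := (e.isUnit_det b).ne_zero
  have h1 : wedge (Ω i) (Ω j) b = (2 * (A * A.transpose) i j) * e.det b := by
    have := congrArg (fun F => F b) (h.wedge_eq i j)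
    exact this
  rw [inducedQ, Matrix.of_apply, h1, (h.induced_eq b).1, AlternatingMap.smul_apply, smul_eq_mul,
    Matrix.smul_apply, smul_eq_mul]
  have := h.det_sq
  have := h.det_ne_zero
  field_simp
  linear_combination (-((A * A.transpose) i j)) * h.det_sq

theorem det_inducedQ (h : IsNormalFrame Ω e A) (b : Module.Basis (Fin 4) ℝ V) :
    (inducedQ b Ω).det = A.det := by
  rw [h.inducedQ_eq b, Matrix.det_smul, Matrix.det_mul, Matrix.det_transpose]
  simp only [Fintype.card_fin]
  linear_combination (A.det ^ 3 + A.det) * h.det_sq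

/-- In an orthonormal frame `E_i` acts on components by the matrix of `Ω_i`. The factor `det A`
compares `μ` with `e.det`, since the star of `E_i` is that of `μ`. -/
theorem opE_apply_basis (h : IsNormalFrame Ω e A) (b : Module.Basis (Fin 4) ℝ V) (i : Fin 3)
    (α : V →ₗ[ℝ] ℝ) (t : Fin 4) :
    opE b Ω i α (e t) = A.det * ∑ j, A i j * ∑ d, stdForm j t d * α (e d) := by
  have h1 := hodgeStar_three_apply b e (inducedMetric b Ω)
    (fun v w => by rw [(h.induced_eq b).2]) (inducedVolume b Ω) (wedge (oneForm α) (Ω i)) t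
  have h2 : ∀ x, wedge (oneForm α) (Ω i) x = _ := wedge_one_two (oneForm α) (Ω i)
  have h3 : ∀ v, oneForm α ![v] = α v := fun v => rfl
  rw [opE, LinearMap.neg_apply, linearForm_apply, h1]
  simp only [h2, h3, (h.induced_eq b).1, AlternatingMap.smul_apply, e.det_self, Matrix.cons_val,
    h.apply_basis]
  have ha : ∀ d, α (e d) = (fun d => α (e d)) d := fun d => rfl
  generalize (fun d => α (e d)) = a at ha
  simp only [ha]
  fin_cases t <;> simp [Fin.sum_univ_four, Fin.sum_univ_three, stdForm, eps₄] <;> ring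

theorem orientedVolume_eq (h : IsNormalFrame Ω e A) (b : Module.Basis (Fin 4) ℝ V) :
    orientedVolume e.orientation b (inducedMetric b Ω) = e.det := by
  have hb : e.det b ≠ 0 := (e.isUnit_det b).ne_zero
  have hs : √(gram b (inducedMetric b Ω)).det = |e.det b| := by
    rw [(h.induced_eq b).2, gram_eq, Matrix.det_mul, Matrix.det_transpose, ← sq, Real.sqrt_sq_eq_abs,
      Module.Basis.det_apply]
  have h1 : e.det b * b.det e = 1 := by
    have := congrArg (fun F => F e) (four_eq_smul_det b e.det)
    rw [AlternatingMap.smul_apply, smul_eq_mul, e.det_self] at this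
    exact this.symm
  rw [four_eq_smul_det b e.det, orientedVolume, hs]
  congr 1
  have h2 : b.orientation = e.orientation ↔ 0 < e.det b := by
    rw [eq_comm, Module.Basis.orientation_eq_iff_det_pos]
  by_cases hp : 0 < e.det b
  · rw [if_pos (h2.2 hp), abs_of_pos hp, one_mul]
  · rw [if_neg (fun hh => hp (h2.1 hh)), abs_of_neg (lt_of_le_of_ne (not_lt.1 hp) hb)]
    ring

/-- Self-duality refers to the orientation of `e`, hence to `e.det` and not to `μ = det A · e.det`;
the sign of `det A` plays no role. The same three equations describe the span of the triple in
`mem_span_iff`. -/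
theorem isSelfDual_iff (h : IsNormalFrame Ω e A) (b : Module.Basis (Fin 4) ℝ V)
    (η : V [⋀^Fin 2]→ₗ[ℝ] ℝ) :
    IsSelfDual e.orientation b (inducedMetric b Ω) η ↔
      η ![e 0, e 1] = η ![e 2, e 3] ∧ η ![e 0, e 2] = -η ![e 1, e 3] ∧
        η ![e 0, e 3] = η ![e 1, e 2] := by
  have hs := hodgeStar_two_apply b e (inducedMetric b Ω)
    (fun v w => by rw [(h.induced_eq b).2]) e.det η
  rw [IsSelfDual, h.orientedVolume_eq]
  simp only [e.det_self, Fin.sum_univ_four] at hs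
  have hd : ∀ v, η ![v, v] = 0 := fun v => by
    have := two_swap η v v
    linarith
  simp only [hd, two_swap η (e 1) (e 0), two_swap η (e 2) (e 0), two_swap η (e 3) (e 0),
    two_swap η (e 2) (e 1), two_swap η (e 3) (e 1), two_swap η (e 3) (e 2)] at hs
  constructor
  · intro hη
    rw [hη] at hs
    have h1 := hs 0 1
    have h2 := hs 0 2
    have h3 := hs 0 3
    simp [eps₄] at h1 h2 h3
    refine ⟨by linarith, by linarith, by linarith⟩
  · rintro ⟨h1, h2, h3⟩
    have hb : ∀ s t, hodgeStar (k := 2) (l := 2) b (inducedMetric b Ω) e.det η ![e s, e t] =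
        η ![e s, e t] := by
      intro s t
      rw [hs]
      fin_cases s <;> fin_cases t <;> simp [eps₄, hd, two_swap η (e 1) (e 0),
        two_swap η (e 2) (e 0), two_swap η (e 3) (e 0),
        two_swap η (e 2) (e 1), two_swap η (e 3) (e 1), two_swap η (e 3) (e 2)] <;> linarith
    ext v
    rw [fin_two_fun_eq v]
    refine (two_apply_eq_sum _ e _ _).trans ((two_apply_eq_sum _ e _ _).trans ?_).symm
    simp only [hb]

theorem matrix_eq (h : IsNormalFrame Ω e A) (b : Module.Basis (Fin 4) ℝ V) (i : Fin 3) :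
    Matrix.of (fun p q => Ω i ![b p, b q]) =
      (e.toMatrix b).transpose * (∑ j, A i j • stdForm j) * e.toMatrix b := by
  ext p q
  rw [Matrix.of_apply, two_apply_eq_sum _ e]
  simp only [Matrix.mul_apply, h.apply_basis, Module.Basis.toMatrix_apply, Matrix.transpose_apply,
    Matrix.sum_apply, Matrix.smul_apply, smul_eq_mul, Finset.sum_mul]
  simp only [Fin.sum_univ_four, Fin.sum_univ_three]
  ring

/-- The standard matrices satisfy `σ_i σ_j + σ_j σ_i = -2 δ_ij`, which gives the relation in the
frame `e`; a change of basis acts by congruence and `g⁻¹` absorbs the middle factors. An arbitrary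
basis is allowed because the relation is later differentiated in a constant basis, while normal
frames vary from point to point. -/
theorem clifford (h : IsNormalFrame Ω e A) (b : Module.Basis (Fin 4) ℝ V) (i j : Fin 3) :
    Matrix.of (fun p q => Ω i ![b p, b q]) * (gram b (inducedMetric b Ω))⁻¹ *
        Matrix.of (fun p q => Ω j ![b p, b q]) +
      Matrix.of (fun p q => Ω j ![b p, b q]) * (gram b (inducedMetric b Ω))⁻¹ *
        Matrix.of (fun p q => Ω i ![b p, b q]) =
      (-2 * (A * A.transpose) i j) • gram b (inducedMetric b Ω) := by
  set P := e.toMatrix b with hP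
  have hu : IsUnit P.det := (e.isUnit_det b)
  have hPP : P * P⁻¹ = 1 := Matrix.mul_nonsing_inv P hu
  have hPT : (P⁻¹).transpose * P.transpose = 1 := by
    rw [← Matrix.transpose_mul, hPP, Matrix.transpose_one]
  have key : ∀ S S' : Matrix (Fin 4) (Fin 4) ℝ,
      P.transpose * S * P * (P⁻¹ * (P⁻¹).transpose) * (P.transpose * S' * P) =
        P.transpose * (S * S') * P := by
    intro S S'
    calc _ = P.transpose * S * (P * P⁻¹) * ((P⁻¹).transpose * P.transpose) * S' * P := by
          simp only [Matrix.mul_assoc]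
      _ = _ := by rw [hPP, hPT]; simp only [Matrix.mul_assoc, Matrix.mul_one]
  have hS : (∑ k, A i k • stdForm k) * (∑ k, A j k • stdForm k) +
      (∑ k, A j k • stdForm k) * (∑ k, A i k • stdForm k) =
      (-2 * (A * A.transpose) i j) • (1 : Matrix (Fin 4) (Fin 4) ℝ) := by
    ext p q
    simp only [Matrix.add_apply, Matrix.mul_apply, Fin.sum_univ_four, Fin.sum_univ_three,
      Matrix.smul_apply, smul_eq_mul, Matrix.transpose_apply]
    fin_cases p <;> fin_cases q <;> simp [stdForm] <;> ring
  rw [h.matrix_eq, h.matrix_eq, (h.induced_eq b).2, gram_eq, ← hP, Matrix.mul_inv_rev,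
    ← Matrix.transpose_nonsing_inv, key, key, ← Matrix.add_mul, ← Matrix.mul_add, hS]
  simp

theorem linearIndependent (h : IsNormalFrame Ω e A) : LinearIndependent ℝ Ω := by
  rw [Fintype.linearIndependent_iff]
  intro c hc
  have h1 : Matrix.vecMul c A = 0 := by
    ext j
    have := congrArg (fun F => F ![e 0, e (![1, 2, 3] j)]) hc
    simp only [alternating_sum_apply, AlternatingMap.smul_apply, h.apply_basis] at this
    fin_cases j <;> simp [stdForm, Fin.sum_univ_three] at this <;>
      simp [Matrix.vecMul, dotProduct, Fin.sum_univ_three, this]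
  have h2 := Matrix.eq_zero_of_vecMul_eq_zero h.det_ne_zero h1
  exact fun i => congrFun h2 i

theorem mem_span_iff (h : IsNormalFrame Ω e A) (η : V [⋀^Fin 2]→ₗ[ℝ] ℝ) :
    η ∈ Submodule.span ℝ (Set.range Ω) ↔
      η ![e 0, e 1] = η ![e 2, e 3] ∧ η ![e 0, e 2] = -η ![e 1, e 3] ∧
        η ![e 0, e 3] = η ![e 1, e 2] := by
  rw [Submodule.mem_span_range_iff_exists_fun]
  constructor
  · rintro ⟨c, rfl⟩
    simp only [alternating_sum_apply, AlternatingMap.smul_apply, h.apply_basis]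
    simp [stdForm, Fin.sum_univ_three]
  · rintro ⟨h1, h2, h3⟩
    have hd : ∀ v, η ![v, v] = 0 := fun v => by
      have := two_swap η v v
      linarith
    let x : Fin 3 → ℝ := fun j => η ![e 0, e (![1, 2, 3] j)]
    refine ⟨Matrix.vecMul x A⁻¹, ?_⟩
    have hx : ∀ j, ∑ i, Matrix.vecMul x A⁻¹ i * A i j = x j := by
      intro j
      have : Matrix.vecMul (Matrix.vecMul x A⁻¹) A = x := by
        rw [Matrix.vecMul_vecMul, Matrix.nonsing_inv_mul A h.isUnit_det, Matrix.vecMul_one]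
      exact congrFun this j
    have hb : ∀ s t, (∑ i, Matrix.vecMul x A⁻¹ i • Ω i) ![e s, e t] = η ![e s, e t] := by
      intro s t
      have : (∑ i, Matrix.vecMul x A⁻¹ i • Ω i) ![e s, e t] = ∑ j, x j * stdForm j s t := by
        simp only [alternating_sum_apply, AlternatingMap.smul_apply, h.apply_basis, smul_eq_mul,
          ← hx, Finset.mul_sum, Finset.sum_mul]
        rw [Finset.sum_comm]
        simp only [mul_assoc]
      rw [this]
      fin_cases s <;> fin_cases t <;> simp [stdForm, x, Fin.sum_univ_three, hd,
        two_swap η (e 1) (e 0), two_swap η (e 2) (e 0), two_swap η (e 3) (e 0),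
        two_swap η (e 2) (e 1), two_swap η (e 3) (e 1), two_swap η (e 3) (e 2)] <;> linarith
    ext v
    rw [fin_two_fun_eq v]
    refine (two_apply_eq_sum _ e _ _).trans ((two_apply_eq_sum _ e _ _).trans ?_).symm
    simp only [hb]

end IsNormalFrame
end NormalFrame

/-! ### Frames from Clifford relations of skew matrices -/

section CliffordRelations

/-- The Euclidean dual of a skew matrix. -/
def skewDual (M : Matrix (Fin 4) (Fin 4) ℝ) : Matrix (Fin 4) (Fin 4) ℝ :=
  !![0, M 2 3, -M 1 3, M 1 2; -M 2 3, 0, M 0 3, -M 0 2; M 1 3, -M 0 3, 0, M 0 1;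
    -M 1 2, M 0 2, -M 0 1, 0]

theorem skewDual_transpose (M : Matrix (Fin 4) (Fin 4) ℝ) :
    (skewDual M).transpose = -skewDual M := by
  ext i j
  fin_cases i <;> fin_cases j <;> simp [skewDual]

/-- The polarization of `M · skewDual M = -Pf(M) · 1`. It converts the wedge pairing of 2-covectors
into matrix identities. -/
theorem skewDual_mul_add (M N : Matrix (Fin 4) (Fin 4) ℝ) (hM : M.transpose = -M)
    (hN : N.transpose = -N) :
    M * skewDual N + N * skewDual M = (-(M 0 1 * N 2 3 - M 0 2 * N 1 3 + M 0 3 * N 1 2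
      + M 1 2 * N 0 3 - M 1 3 * N 0 2 + M 2 3 * N 0 1)) • (1 : Matrix (Fin 4) (Fin 4) ℝ) := by
  have hM' : ∀ i j, M i j = -M j i := fun i j => congrFun (congrFun hM j) i
  have hN' : ∀ i j, N i j = -N j i := fun i j => congrFun (congrFun hN j) i
  have hM0 : ∀ i, M i i = 0 := fun i => by linarith [hM' i i]
  have hN0 : ∀ i, N i i = 0 := fun i => by linarith [hN' i i]
  ext i j
  simp only [Matrix.add_apply, Matrix.mul_apply, Fin.sum_univ_four]
  fin_cases i <;> fin_cases j <;> simp [skewDual, hM0, hN0, hM' 1 0, hM' 2 0, hM' 3 0, hM' 2 1,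
    hM' 3 1, hM' 3 2, hN' 1 0, hN' 2 0, hN' 3 0, hN' 2 1, hN' 3 1, hN' 3 2] <;> ring

variable {a b : Fin 3 → Matrix (Fin 4) (Fin 4) ℝ}

theorem exists_quadratic_ne_zero {n : ℕ} {K : Matrix (Fin n) (Fin n) ℝ} (hK : K.transpose = K)
    (h0 : K ≠ 0) : ∃ v : Fin n → ℝ, v ⬝ᵥ K.mulVec v ≠ 0 := by
  by_contra! h
  apply h0
  have hsymm : ∀ v w, v ⬝ᵥ K.mulVec w = w ⬝ᵥ K.mulVec v := fun v w => by
    rw [Matrix.dotProduct_mulVec, ← Matrix.mulVec_transpose, hK, dotProduct_comm]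
  ext i j
  have h1 := h (Pi.single i 1 + Pi.single j 1)
  have h2 := h (Pi.single i 1)
  have h3 := h (Pi.single j 1)
  have h4 := hsymm (Pi.single i 1) (Pi.single j 1)
  simp only [Matrix.mulVec_add, add_dotProduct, dotProduct_add] at h1
  have h5 : (Pi.single i 1 : Fin n → ℝ) ⬝ᵥ K.mulVec (Pi.single j 1) = K i j := by
    simp
  rw [Matrix.zero_apply, ← h5]
  linarith

/-- A triple of skew matrices with the Clifford relations is standard in the frame
`v, b₁a₂v, b₂a₀v, b₀a₁v`. -/
theorem exists_frame_of_clifford (ha : ∀ i, (a i).transpose = -a i)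
    (hb : ∀ i, (b i).transpose = -b i)
    (hab : ∀ i j, a i * b j + a j * b i = (if i = j then -2 else 0 : ℝ) • 1)
    (hba : ∀ i j, b i * a j + b j * a i = (if i = j then -2 else 0 : ℝ) • 1) :
    ∃ (E : Matrix (Fin 4) (Fin 4) ℝ) (κ : ℝ), κ ≠ 0 ∧
      ∀ i, E.transpose * a i * E = κ • stdForm i := by
  have hab1 : ∀ i, a i * b i = -1 := fun i => by
    have := hab i i
    rw [if_pos rfl, ← two_smul ℝ, neg_smul, ← smul_neg] at this
    exact smul_right_injective _ (two_ne_zero) this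
  have hba1 : ∀ i, b i * a i = -1 := fun i => by
    have := hba i i
    rw [if_pos rfl, ← two_smul ℝ, neg_smul, ← smul_neg] at this
    exact smul_right_injective _ (two_ne_zero) this
  have hab2 : ∀ i j, i ≠ j → a i * b j = -(a j * b i) := fun i j h => by
    have := hab i j
    rw [if_neg h, zero_smul] at this
    exact eq_neg_of_add_eq_zero_left this
  have hba2 : ∀ i j, i ≠ j → b i * a j = -(b j * a i) := fun i j h => by
    have := hba i j
    rw [if_neg h, zero_smul] at this
    exact eq_neg_of_add_eq_zero_left this
  have hab1' : ∀ i x, a i * (b i * x) = -x := fun i x => by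
    rw [← mul_assoc, hab1, neg_one_mul]
  have hba1' : ∀ i x, b i * (a i * x) = -x := fun i x => by
    rw [← mul_assoc, hba1, neg_one_mul]
  have hab2' : ∀ i j x, i ≠ j → a i * (b j * x) = -(a j * (b i * x)) := fun i j x h => by
    rw [← mul_assoc, hab2 i j h, neg_mul, mul_assoc]
  have hba2' : ∀ i j x, i ≠ j → b i * (a j * x) = -(b j * (a i * x)) := fun i j x h => by
    rw [← mul_assoc, hba2 i j h, neg_mul, mul_assoc]
  have a10 := hab2 1 0 (by decide)
  have a20 := hab2 2 0 (by decide)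
  have a21 := hab2 2 1 (by decide)
  have b10 := hba2 1 0 (by decide)
  have b20 := hba2 2 0 (by decide)
  have b21 := hba2 2 1 (by decide)
  have a10' := fun x => hab2' 1 0 x (by decide)
  have a20' := fun x => hab2' 2 0 x (by decide)
  have a21' := fun x => hab2' 2 1 x (by decide)
  have b10' := fun x => hba2' 1 0 x (by decide)
  have b20' := fun x => hba2' 2 0 x (by decide)
  have b21' := fun x => hba2' 2 1 x (by decide)
  have hKT : (a 0 * (b 1 * a 2)).transpose = a 0 * (b 1 * a 2) := by
    rw [Matrix.transpose_mul, Matrix.transpose_mul, ha, ha, hb]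
    simp only [neg_mul, mul_neg, neg_neg, mul_assoc, a21, b20, a10']
  -- Every `a i` and `b i` is invertible, so the product cannot vanish; the factors are removed one
  -- after another.
  have hK0 : a 0 * (b 1 * a 2) ≠ 0 := by
    intro h0
    have h1 : b 2 * (a 1 * (b 0 * (a 0 * (b 1 * a 2)))) = 0 := by simp [h0]
    rw [hba1', mul_neg, mul_neg, hab1', mul_neg, neg_neg, hba1] at h1
    exact one_ne_zero (neg_eq_zero.1 h1)
  -- A nonzero symmetric matrix has a nonzero quadratic form. Its value at `v` will be the scale
  -- `κ`.
  obtain ⟨v, hv⟩ := exists_quadratic_ne_zero hKT hK0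
  let J : Fin 4 → Matrix (Fin 4) (Fin 4) ℝ := ![1, b 1 * a 2, b 2 * a 0, b 0 * a 1]
  refine ⟨Matrix.of fun q p => (J p).mulVec v q, v ⬝ᵥ (a 0 * (b 1 * a 2)).mulVec v, hv, fun i => ?_⟩
  have hskew : ∀ i, v ⬝ᵥ (a i).mulVec v = 0 := fun i => by
    have : v ⬝ᵥ (a i).mulVec v = -(v ⬝ᵥ (a i).mulVec v) := by
      conv_lhs => rw [Matrix.dotProduct_mulVec, ← Matrix.mulVec_transpose, ha, dotProduct_comm,
        Matrix.neg_mulVec, dotProduct_neg]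
    linarith
  have hentry : ∀ p q, ((Matrix.of fun q p => (J p).mulVec v q).transpose * a i *
      (Matrix.of fun q p => (J p).mulVec v q)) p q =
      v ⬝ᵥ ((J p).transpose * (a i * J q)).mulVec v := by
    intro p q
    rw [← Matrix.mulVec_mulVec, ← Matrix.mulVec_mulVec, Matrix.dotProduct_mulVec v,
      Matrix.vecMul_transpose, Matrix.mul_assoc]
    rfl
  ext p q
  rw [hentry]
  -- Each `J_pᵀ a_i J_q` is an odd word. The relations reduce it, up to sign, to one `a_j`, whose
  -- quadratic form vanishes by skewness, or to `a₀ b₁ a₂`, which contributes `±κ`.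
  fin_cases i <;> fin_cases p <;> fin_cases q <;>
    simp [J, ha, hb, mul_assoc, a10, a20, a21, b10, b20, b21, a10', a20', a21', b10', b20', hba1, hab1',
      Matrix.neg_mulVec, hskew, stdForm]

end CliffordRelations

/-! ### Existence of normal frames -/

section ExistsNormalFrame

variable {V : Type*} [AddCommGroup V] [Module ℝ V]

theorem exists_basis_of_toMatrix (b : Module.Basis (Fin 4) ℝ V) (E : Matrix (Fin 4) (Fin 4) ℝ)
    (hE : E.det ≠ 0) :
    ∃ e : Module.Basis (Fin 4) ℝ V, ∀ p, e p = ∑ q, E q p • b q := by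
  let v : Fin 4 → V := fun p => ∑ q, E q p • b q
  have hv : b.toMatrix v = E := by
    ext q p
    simp [v, Module.Basis.toMatrix_apply, Finsupp.single_apply]
  have h : IsUnit (b.det v) := by
    rw [Module.Basis.det_apply, hv]
    exact hE.isUnit
  obtain ⟨h1, h2⟩ := (Module.Basis.is_basis_iff_det b).2 h
  exact ⟨Module.Basis.mk h1 h2.ge, fun p => by simp [v]⟩

theorem exists_isNormalFrame_of_posDef (b : Module.Basis (Fin 4) ℝ V)
    (Ω : Fin 3 → V [⋀^Fin 2]→ₗ[ℝ] ℝ)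
    (hpos : (Matrix.of fun i j => wedge (Ω i) (Ω j) b).PosDef) :
    ∃ e A, IsNormalFrame Ω e A := by
  set N : Matrix (Fin 3) (Fin 3) ℝ := Matrix.of fun i j => wedge (Ω i) (Ω j) b with hN
  obtain ⟨B, hB⟩ : ∃ B : Matrix (Fin 3) (Fin 3) ℝ, N = B.transpose * B := by
    open scoped MatrixOrder in
    obtain ⟨B, hB⟩ := CStarAlgebra.nonneg_iff_eq_star_mul_self.mp hpos.posSemidef.nonneg
    exact ⟨B, by simpa [Matrix.star_eq_conjTranspose] using hB⟩
  have hBdet : B.det ≠ 0 := by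
    intro h0
    have := hpos.det_pos
    rw [hB, Matrix.det_mul, h0] at this
    simp at this
  -- With `S Sᵀ = N / 2`, the forms with matrices `M = S⁻¹ W` have wedge products `2 δ_ij`, as the
  -- standard triple does.
  set S : Matrix (Fin 3) (Fin 3) ℝ := (1 / √2) • B.transpose with hS
  have hSdet : S.det ≠ 0 := by
    rw [hS, Matrix.det_smul, Matrix.det_transpose]
    positivity
  have hSS : S * S.transpose = (1 / 2 : ℝ) • N := by
    rw [hS, hB, Matrix.transpose_smul, Matrix.transpose_transpose, Matrix.smul_mul,
      Matrix.mul_smul, smul_smul]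
    congr 1
    rw [div_mul_div_comm, Real.mul_self_sqrt (by norm_num)]
    norm_num
  let W : Fin 3 → Matrix (Fin 4) (Fin 4) ℝ := fun i => Matrix.of fun p q => Ω i ![b p, b q]
  let M : Fin 3 → Matrix (Fin 4) (Fin 4) ℝ := fun i => ∑ j, S⁻¹ i j • W j
  have hSu : IsUnit S.det := hSdet.isUnit
  have hWT : ∀ i, (W i).transpose = -W i := fun i => by
    ext p q
    exact two_swap (Ω i) (b q) (b p)
  have hMT : ∀ i, (M i).transpose = -M i := fun i => by
    simp only [M, Matrix.transpose_sum, Matrix.transpose_smul, hWT, smul_neg, Finset.sum_neg_distrib]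
  have hWM : ∀ i, W i = ∑ j, S i j • M j := fun i => by
    have h1 : S * S⁻¹ = 1 := Matrix.mul_nonsing_inv S hSu
    simp only [M, Finset.smul_sum, smul_smul]
    rw [Finset.sum_comm]
    simp only [← Finset.sum_smul, ← Matrix.mul_apply, h1, Matrix.one_apply, ite_smul, one_smul,
      zero_smul, Finset.sum_ite_eq, Finset.mem_univ, if_true]
  have hNW : ∀ k l, N k l = W k 0 1 * W l 2 3 - W k 0 2 * W l 1 3 + W k 0 3 * W l 1 2
      + W k 1 2 * W l 0 3 - W k 1 3 * W l 0 2 + W k 2 3 * W l 0 1 := fun k l =>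
    wedge_two_two (Ω k) (Ω l) b
  have hNS : S⁻¹ * N * (S⁻¹).transpose = (2 : ℝ) • (1 : Matrix (Fin 3) (Fin 3) ℝ) := by
    have h1 : N = (2 : ℝ) • (S * S.transpose) := by rw [hSS, smul_smul]; norm_num
    have h2 : S.transpose * (S⁻¹).transpose = 1 := by
      rw [← Matrix.transpose_mul, Matrix.nonsing_inv_mul S hSu, Matrix.transpose_one]
    rw [h1, Matrix.mul_smul, Matrix.smul_mul, ← Matrix.mul_assoc, Matrix.nonsing_inv_mul S hSu,
      Matrix.one_mul, h2]
  have hpf : ∀ i j, M i 0 1 * M j 2 3 - M i 0 2 * M j 1 3 + M i 0 3 * M j 1 2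
      + M i 1 2 * M j 0 3 - M i 1 3 * M j 0 2 + M i 2 3 * M j 0 1 = if i = j then 2 else 0 := by
    intro i j
    have h1 := congrFun (congrFun hNS i) j
    simp only [Matrix.smul_apply, Matrix.one_apply, smul_eq_mul, mul_ite, mul_one, mul_zero] at h1
    rw [← h1]
    simp only [M, Matrix.add_apply, Matrix.smul_apply, smul_eq_mul, Matrix.mul_apply,
      Matrix.transpose_apply, Fin.sum_univ_three, hNW]
    ring
  -- Duality is an involution, so the relations with the two factors exchanged come from the same
  -- identity applied to the duals.
  have hdual : ∀ i, skewDual (skewDual (M i)) = M i := by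
    intro i
    have hM' : ∀ p q, M i p q = -M i q p := fun p q => congrFun (congrFun (hMT i) q) p
    have hM0 : ∀ p, M i p p = 0 := fun p => by linarith [hM' p p]
    ext p q
    fin_cases p <;> fin_cases q <;> simp [skewDual, hM0, hM' 1 0, hM' 2 0, hM' 3 0, hM' 2 1,
      hM' 3 1, hM' 3 2]
  obtain ⟨E, κ, hκ, hE⟩ := exists_frame_of_clifford (a := M) (b := fun i => skewDual (M i)) hMT
    (fun i => skewDual_transpose _)
    (fun i j => by
      rw [skewDual_mul_add _ _ (hMT i) (hMT j), hpf]
      split_ifs <;> simp)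
    (fun i j => by
      have h1 := skewDual_mul_add _ _ (skewDual_transpose (M i)) (skewDual_transpose (M j))
      rw [hdual, hdual] at h1
      rw [h1]
      congr 1
      have h2 := hpf i j
      simp [skewDual]
      split_ifs at h2 ⊢ <;> linarith)
  have hEdet : E.det ≠ 0 := by
    intro h0
    have h1 := congrArg Matrix.det (hE 0)
    have h2 : stdForm 0 * stdForm 0 = -1 := by
      ext p q
      fin_cases p <;> fin_cases q <;> simp [stdForm, Matrix.mul_apply, Fin.sum_univ_four]
    have h3 := congrArg Matrix.det h2
    rw [Matrix.det_mul, Matrix.det_neg] at h3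
    rw [Matrix.det_mul, h0, mul_zero, Matrix.det_smul, eq_comm] at h1
    have h4 : (stdForm 0).det = 0 := by
      rcases mul_eq_zero.1 h1 with h | h
      · exact absurd h (pow_ne_zero _ hκ)
      · exact h
    rw [h4] at h3
    norm_num at h3
  -- Scaling the frame by `c` multiplies the coefficient matrix by `c²`. With `c⁶ = 1 / |x|`, its
  -- determinant `(c² κ)³ det S` becomes `x / |x| = ±1`.
  set x := κ ^ 3 * S.det with hx
  have hx0 : x ≠ 0 := mul_ne_zero (pow_ne_zero _ hκ) hSdet
  set c : ℝ := |x|⁻¹ ^ (1 / 6 : ℝ) with hc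
  have hc6 : c ^ 6 = |x|⁻¹ := by
    rw [hc, one_div]
    exact_mod_cast Real.rpow_inv_natCast_pow (inv_nonneg.2 (abs_nonneg x)) (by norm_num : (6 : ℕ) ≠ 0)
  have hc0 : c ≠ 0 := by
    intro h0
    rw [h0] at hc6
    have := inv_ne_zero (abs_ne_zero.2 hx0)
    rw [← hc6] at this
    simp at this
  obtain ⟨e, he⟩ := exists_basis_of_toMatrix b (c • E) (by
    rw [Matrix.det_smul]
    exact mul_ne_zero (pow_ne_zero _ hc0) hEdet)
  refine ⟨e, (c ^ 2 * κ) • S, ?_, fun i p q => ?_⟩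
  · rw [Matrix.det_smul]
    simp only [Fintype.card_fin]
    have h1 : (c ^ 2 * κ) ^ 3 * S.det = |x|⁻¹ * x := by
      rw [← hc6, hx]
      ring
    rw [h1, mul_pow, inv_pow, sq_abs]
    exact inv_mul_cancel₀ (pow_ne_zero _ hx0)
  · have hrepr : ∀ p q, b.repr (e p) q = c * E q p := fun p q => by
      rw [he]
      simp [Finsupp.single_apply]
    have h1 : ∀ j, (∑ p', ∑ q', E p' p * E q' q * M j p' q') = κ * stdForm j p q := fun j => by
      rw [← smul_eq_mul, ← Matrix.smul_apply, ← hE j]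
      simp only [Matrix.mul_apply, Matrix.transpose_apply, Fin.sum_univ_four]
      ring
    rw [two_apply_eq_sum _ b]
    simp only [hrepr]
    have h2 : ∀ p' q', Ω i ![b p', b q'] = ∑ j, S i j * M j p' q' := fun p' q' => by
      have := congrFun (congrFun (hWM i) p') q'
      simpa [W, Matrix.sum_apply] using this
    simp only [h2, Matrix.smul_apply, smul_eq_mul]
    have h3 : ∀ j, (c ^ 2 * κ * S i j) * stdForm j p q =
        c ^ 2 * S i j * ∑ p', ∑ q', E p' p * E q' q * M j p' q' := fun j => by
      rw [h1]
      ring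
    simp only [h3, Fin.sum_univ_four, Fin.sum_univ_three]
    ring

theorem exists_isNormalFrame (o : Orientation ℝ V (Fin 4)) (b₀ : Module.Basis (Fin 4) ℝ V)
    (Ω : Fin 3 → V [⋀^Fin 2]→ₗ[ℝ] ℝ)
    (hpos : ∀ e : Module.Basis (Fin 4) ℝ V, e.orientation = o →
      (Matrix.of fun i j => wedge (Ω i) (Ω j) e).PosDef) :
    ∃ e A, IsNormalFrame Ω e A ∧ e.orientation = o := by
  have hb := b₀.orientation_adjustToOrientation o
  set b := b₀.adjustToOrientation o
  obtain ⟨e, A, h⟩ := exists_isNormalFrame_of_posDef b Ω (hpos b hb)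
  refine ⟨e, A, h, ?_⟩
  rw [← hb, Module.Basis.orientation_eq_iff_det_pos]
  -- `Ω₀ ∧ Ω₀` is positive on the oriented basis `b` and a nonnegative multiple of `e.det`, so `e`
  -- is oriented as well.
  have h1 := (hpos b hb).diag_pos (i := 0)
  have h2 : wedge (Ω 0) (Ω 0) b = (2 * (A * A.transpose) 0 0) * e.det b :=
    congrArg (fun F => F b) (h.wedge_eq 0 0)
  rw [Matrix.of_apply, h2] at h1
  have h3 : 0 ≤ 2 * (A * A.transpose) 0 0 := by
    simp only [Matrix.mul_apply, Matrix.transpose_apply, Fin.sum_univ_three]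
    nlinarith [mul_self_nonneg (A 0 0), mul_self_nonneg (A 0 1), mul_self_nonneg (A 0 2)]
  exact pos_of_mul_pos_right h1 h3

end ExistsNormalFrame

/-! ### The algebraic core for the standard triple -/

section Core

/-- The torsion forms in a frame in which the triple is standard. -/
def stdTau (r : Fin 3 → Fin 3 → Fin 4 → ℝ) (k : Fin 3) (u : Fin 4) : ℝ :=
  -∑ l, ∑ d, stdForm l u d * r k l d

set_option maxHeartbeats 1000000 in
/-- A tensor with the symmetries of the covariant derivative of the standard triple is determined by
the derivative of its Gram matrix. -/
theorem eq_sum_stdForm (k : Fin 3 → Fin 4 → Matrix (Fin 4) (Fin 4) ℝ)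
    (r : Fin 3 → Fin 3 → Fin 4 → ℝ) (hskew : ∀ i u, (k i u).transpose = -k i u)
    (hcliff : ∀ i j u, k i u * stdForm j + stdForm i * k j u +
      (k j u * stdForm i + stdForm j * k i u) = (-2 * r i j u) • (1 : Matrix (Fin 4) (Fin 4) ℝ))
    (hcyc : ∀ i u p q, k i u p q + k i p q u + k i q u p = 0)
    (htr : ∀ u, r 0 0 u + r 1 1 u + r 2 2 u = 0) (i : Fin 3) (u : Fin 4) :
    k i u = ∑ j, (1 / 2 * r i j u + 1 / 2 * ∑ l, eps i j l * stdTau r l u) • stdForm j := by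
  have hs : ∀ i u p q, k i u p q = -k i u q p := fun i u p q =>
    congrFun (congrFun (hskew i u) q) p
  have h0 : ∀ i u p, k i u p p = 0 := fun i u p => by linarith [hs i u p p]
  have hrs : ∀ i j u, r i j u = r j i u := fun i j u => by
    have h1 := congrFun (congrFun (hcliff i j u) 0) 0
    have h2 := congrFun (congrFun (hcliff j i u) 0) 0
    simp only [Matrix.add_apply, Matrix.smul_apply, Matrix.one_apply_eq, smul_eq_mul] at h1 h2
    linarith
  have hc : ∀ i j u p q, ∑ m, k i u p m * stdForm j m q + ∑ m, stdForm i p m * k j u m q +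
      (∑ m, k j u p m * stdForm i m q + ∑ m, stdForm j p m * k i u m q) =
      -2 * r i j u * (1 : Matrix (Fin 4) (Fin 4) ℝ) p q := fun i j u p q =>
    congrFun (congrFun (hcliff i j u) p) q
  simp only [Fin.sum_univ_four] at hc
  -- The case `i = j` says that the anticommutator of `k i u` and `σ_i` is a scalar. The
  -- anti-self-dual part of `k i u` commutes with `σ_i`, and their product is trace free, so this
  -- part must vanish.
  have hsd : ∀ i u, k i u 2 3 = k i u 0 1 ∧ k i u 1 3 = -k i u 0 2 ∧ k i u 1 2 = k i u 0 3 := by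
    intro i u
    have e1 := hc i i u 0 0
    have e2 := hc i i u 0 2
    have e3 := hc i i u 0 3
    have e4 := hc i i u 0 1
    have e5 := hc i i u 2 2
    have e6 := hc i i u 1 1
    fin_cases i <;> simp [stdForm, h0, hs _ _ 1 0, hs _ _ 2 0,
      hs _ _ 3 0, hs _ _ 2 1, hs _ _ 3 1, hs _ _ 3 2] at e1 e2 e3 e4 e5 e6 ⊢ <;>
      refine ⟨by linarith, by linarith, by linarith⟩
  have hd : ∀ u, k 0 u 0 1 = r 0 0 u / 2 ∧ k 1 u 0 2 = r 1 1 u / 2 ∧ k 2 u 0 3 = r 2 2 u / 2 := by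
    intro u
    have e1 := hc 0 0 u 0 0
    have e2 := hc 1 1 u 0 0
    have e3 := hc 2 2 u 0 0
    simp [stdForm, h0, hs _ _ 1 0, hs _ _ 2 0,
      hs _ _ 3 0] at e1 e2 e3
    refine ⟨by linarith, by linarith, by linarith⟩
  -- Only the symmetric part of the coefficient matrix is visible to the Clifford relation; the
  -- antisymmetric part remains unknown.
  have ho : ∀ u, k 0 u 0 2 + k 1 u 0 1 = r 0 1 u ∧ k 0 u 0 3 + k 2 u 0 1 = r 0 2 u ∧
      k 1 u 0 3 + k 2 u 0 2 = r 1 2 u := by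
    intro u
    have e1 := hc 0 1 u 0 0
    have e2 := hc 0 2 u 0 0
    have e3 := hc 1 2 u 0 0
    simp [stdForm, h0, hs _ _ 1 0, hs _ _ 2 0,
      hs _ _ 3 0] at e1 e2 e3
    refine ⟨by linarith, by linarith, by linarith⟩
  have hb : ∀ i u, k i u = k i u 0 1 • stdForm 0 + k i u 0 2 • stdForm 1 + k i u 0 3 • stdForm 2 := by
    intro i u
    obtain ⟨h1, h2, h3⟩ := hsd i u
    ext p q
    fin_cases p <;> fin_cases q <;> simp [stdForm, h0, hs _ _ 1 0, hs _ _ 2 0,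
      hs _ _ 3 0, hs _ _ 2 1, hs _ _ 3 1, hs _ _ 3 2, h1, h2, h3]
  have hcy : ∀ i, _ ∧ _ ∧ _ ∧ _ := fun i => ⟨hcyc i 0 1 2, hcyc i 0 1 3, hcyc i 0 2 3, hcyc i 1 2 3⟩
  simp only [hs _ _ 2 0, hs _ _ 3 0, hs _ _ 3 1] at hcy
  simp only [(hsd _ _).1, (hsd _ _).2.1, (hsd _ _).2.2] at hcy
  -- Four cyclic identities for each of the three forms determine the three antisymmetric
  -- coefficients for each of the four `u`. The trace condition enters here, to eliminate sums of
  -- two diagonal entries of `r`.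
  have hx : ∀ u, k 0 u 0 2 = 1 / 2 * r 0 1 u + 1 / 2 * stdTau r 2 u ∧
      k 0 u 0 3 = 1 / 2 * r 0 2 u - 1 / 2 * stdTau r 1 u ∧
      k 1 u 0 3 = 1 / 2 * r 1 2 u + 1 / 2 * stdTau r 0 u := by
    intro u
    have A := hcy 0
    have B := hcy 1
    have C := hcy 2
    have d0 := hd 0
    have d1 := hd 1
    have d2 := hd 2
    have d3 := hd 3
    have o0 := ho 0
    have o1 := ho 1
    have o2 := ho 2
    have o3 := ho 3
    have t0 := htr 0
    have t1 := htr 1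
    have t2 := htr 2
    have t3 := htr 3
    fin_cases u <;> simp [stdTau, stdForm, Fin.sum_univ_three, Fin.sum_univ_four, hrs 1 0, hrs 2 0,
      hrs 2 1] <;> refine ⟨by linarith, by linarith, by linarith⟩
  rw [hb i u]
  obtain ⟨d1, d2, d3⟩ := hd u
  obtain ⟨o1, o2, o3⟩ := ho u
  obtain ⟨x1, x2, x3⟩ := hx u
  rw [Fin.sum_univ_three]
  congr 2
  · congr 1
    fin_cases i <;> simp [eps, Fin.sum_univ_three, hrs 1 0, hrs 2 0] <;> linarith
  · congr 1
    fin_cases i <;> simp [eps, Fin.sum_univ_three, hrs 2 1] <;> linarith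
  · fin_cases i <;> simp [eps, Fin.sum_univ_three] <;> linarith

end Core

/-! ### From the standard triple to a unimodular transform -/

section Core

/-- The torsion forms `τ_m` in a normal frame, where `q u = dQ(e_u)`. -/
def frameTau (A : Matrix (Fin 3) (Fin 3) ℝ) (q : Fin 4 → Matrix (Fin 3) (Fin 3) ℝ) (m : Fin 3)
    (u : Fin 4) : ℝ :=
  -∑ k, A.det * ∑ p, A k p * ∑ d, stdForm p u d * (q d * (A.det • (A * A.transpose))⁻¹) m k

/-- The connection matrix in a normal frame, where `q u = dQ(e_u)`. -/
def frameConnection (A : Matrix (Fin 3) (Fin 3) ℝ) (q : Fin 4 → Matrix (Fin 3) (Fin 3) ℝ)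
    (i j : Fin 3) (u : Fin 4) : ℝ :=
  1 / 2 * (q u * (A.det • (A * A.transpose))⁻¹) i j +
    ∑ k, (A.det • (A * A.transpose))⁻¹ k j *
      (1 / 2 * ∑ l, ∑ m, eps i k l * (A.det • (A * A.transpose))⁻¹ l m * frameTau A q m u)

/-- The left side is the cross product of the rows `i` and `k` of `A`. Its entries are cofactors,
and the adjugate is `det A · A⁻¹`. -/
theorem sum_mul_eps (A B : Matrix (Fin 3) (Fin 3) ℝ) (hA : A.det ^ 2 = 1) (hB : A * B = 1)
    (i k n : Fin 3) :
    ∑ l, ∑ j, A i l * eps l j n * A k j = A.det * ∑ l, eps i k l * B n l := by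
  have hu : IsUnit A.det := by
    refine isUnit_iff_ne_zero.2 fun h0 => ?_
    simp [h0] at hA
  have h1 : A.det • B = A.adjugate := by
    rw [← Matrix.inv_eq_right_inv hB, Matrix.inv_def, smul_smul, Ring.mul_inverse_cancel _ hu,
      one_smul]
  have h2 : ∀ n l, A.det * B n l = A.adjugate n l := fun n l => by
    rw [← h1]; rfl
  rw [Finset.mul_sum]
  simp only [show ∀ l, A.det * (eps i k l * B n l) = eps i k l * (A.det * B n l) from
    fun l => by ring, h2, Matrix.adjugate_fin_three]
  fin_cases i <;> fin_cases k <;> fin_cases n <;> simp [Fin.sum_univ_three, eps] <;> ring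

theorem inv_smul_mul_transpose (A B : Matrix (Fin 3) (Fin 3) ℝ) (hA : A.det ^ 2 = 1)
    (hB : A * B = 1) :
    (A.det • (A * A.transpose))⁻¹ = A.det • (B.transpose * B) := by
  have hB' : B * A = 1 := mul_eq_one_comm.1 hB
  have hBT : A.transpose * B.transpose = 1 := by
    rw [← Matrix.transpose_mul, hB', Matrix.transpose_one]
  refine Matrix.inv_eq_right_inv ?_
  rw [Matrix.smul_mul, Matrix.mul_smul, smul_smul, ← sq, hA, one_smul, Matrix.mul_assoc,
    ← Matrix.mul_assoc A.transpose, hBT, Matrix.one_mul, hB]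

/-- In a normal frame, the derivative of the frame in terms of the standard triple. -/
theorem frameConnection_eq (A B : Matrix (Fin 3) (Fin 3) ℝ) (hA : A.det ^ 2 = 1)
    (hB : A * B = 1) (q : Fin 4 → Matrix (Fin 3) (Fin 3) ℝ) (i j : Fin 3) (u : Fin 4) :
    frameConnection A q i j u = ∑ l, ∑ m, A i l *
      (1 / 2 * (A.det • (B * q u * B.transpose)) l m + 1 / 2 * ∑ n, eps l m n *
        stdTau (fun a b d => (A.det • (B * q d * B.transpose)) a b) n u) * B m j := by
  -- The derivative of the Gram matrix transported back to the standard triple; `dQ Q⁻¹` is then the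
  -- conjugate `A r A⁻¹`.
  set r : Fin 4 → Matrix (Fin 3) (Fin 3) ℝ := fun d => A.det • (B * q d * B.transpose) with hr
  have hBA : B * A = 1 := mul_eq_one_comm.1 hB
  have hqQ : ∀ d, q d * (A.det • (A * A.transpose))⁻¹ = A * r d * B := fun d => by
    rw [inv_smul_mul_transpose A B hA hB, hr]
    simp only [Matrix.mul_smul, Matrix.smul_mul]
    rw [← Matrix.mul_assoc, ← Matrix.mul_assoc A, ← Matrix.mul_assoc A, hB, Matrix.one_mul,
      Matrix.mul_assoc]
  set t : Fin 3 → ℝ := fun n => stdTau (fun a b d => r d a b) n u with ht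
  have hτ : ∀ m, frameTau A q m u = A.det * ∑ n, A m n * t n := by
    intro m
    have h1 : ∀ p d, ∑ k, A k p * (A * r d * B) m k = (A * r d) m p := fun p d => by
      have : A * r d = A * r d * B * A := by rw [Matrix.mul_assoc _ B, hBA, Matrix.mul_one]
      conv_rhs => rw [this, Matrix.mul_apply]
      exact Finset.sum_congr rfl fun k _ => mul_comm _ _
    rw [frameTau]
    simp only [hqQ]
    have h2 : ∑ k, A.det * ∑ p, A k p * ∑ d, stdForm p u d * (A * r d * B) m k =
        A.det * ∑ p, ∑ d, stdForm p u d * (A * r d) m p := by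
      simp only [← h1, ← Finset.mul_sum]
      congr 1
      rw [Finset.sum_comm]
      refine Finset.sum_congr rfl fun p _ => ?_
      simp only [Finset.mul_sum]
      rw [Finset.sum_comm]
      refine Finset.sum_congr rfl fun d _ => Finset.sum_congr rfl fun k _ => by ring
    rw [h2, ht]
    simp only [stdTau, Matrix.mul_apply, Fin.sum_univ_three, Fin.sum_univ_four]
    ring
  have hX : ∀ i k, ∑ l, ∑ m, eps i k l * (A.det • (A * A.transpose))⁻¹ l m * frameTau A q m u =
      ∑ n, (∑ l, eps i k l * B n l) * t n := by
    intro i k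
    have h1 : ∀ l, ∑ m, (A.det • (A * A.transpose))⁻¹ l m * (A.det * ∑ n, A m n * t n) =
        ∑ n, B n l * t n := by
      intro l
      have h2 : (A.det • (A * A.transpose))⁻¹ * (A.det • A) = B.transpose := by
        rw [inv_smul_mul_transpose A B hA hB, Matrix.smul_mul, Matrix.mul_smul, smul_smul, ← sq,
          hA, one_smul, Matrix.mul_assoc, hBA, Matrix.mul_one]
      have h3 : ∀ n, B n l = ∑ m, (A.det • (A * A.transpose))⁻¹ l m * (A.det * A m n) := fun n => by
        rw [← Matrix.transpose_apply B, ← h2, Matrix.mul_apply]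
        rfl
      simp only [h3, Finset.mul_sum, Finset.sum_mul]
      rw [Finset.sum_comm]
      refine Finset.sum_congr rfl fun d _ => Finset.sum_congr rfl fun k _ => by ring
    have h4 : ∀ l, ∑ m, eps i k l * (A.det • (A * A.transpose))⁻¹ l m * frameTau A q m u =
        eps i k l * ∑ n, B n l * t n := fun l => by
      rw [← h1, Finset.mul_sum]
      simp only [hτ, mul_assoc]
    simp only [h4, Finset.mul_sum, Finset.sum_mul]
    rw [Finset.sum_comm]
    refine Finset.sum_congr rfl fun d _ => Finset.sum_congr rfl fun k _ => by ring
  set Y : Matrix (Fin 3) (Fin 3) ℝ := Matrix.of fun i k =>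
    ∑ l, ∑ m, eps i k l * (A.det • (A * A.transpose))⁻¹ l m * frameTau A q m u with hYdef
  set x : Matrix (Fin 3) (Fin 3) ℝ := Matrix.of fun l m => ∑ n, eps l m n * t n with hx
  -- The cofactor identity turns `ε` contracted with `A⁻¹` into `A ε Aᵀ`; the trailing `Aᵀ` is then
  -- cancelled by `Q⁻¹`.
  have hY : A.det • Y = A * x * A.transpose := by
    ext i k
    have h1 : A.det * Y i k = ∑ n, (∑ l, ∑ j, A i l * eps l j n * A k j) * t n := by
      simp only [sum_mul_eps A B hA hB]
      rw [hYdef, Matrix.of_apply, hX, Finset.mul_sum]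
      exact Finset.sum_congr rfl fun n _ => by ring
    rw [Matrix.smul_apply, smul_eq_mul, h1]
    simp only [Matrix.mul_apply, Matrix.transpose_apply, hx, Matrix.of_apply, Fin.sum_univ_three]
    ring
  have hYQ : Y * (A.det • (A * A.transpose))⁻¹ = A * x * B := by
    have hAB : A.transpose * B.transpose = 1 := by
      rw [← Matrix.transpose_mul, hBA, Matrix.transpose_one]
    rw [inv_smul_mul_transpose A B hA hB, Matrix.mul_smul, ← Matrix.smul_mul, hY,
      Matrix.mul_assoc, ← Matrix.mul_assoc A.transpose, hAB, Matrix.one_mul]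
  have hl : frameConnection A q i j u = 1 / 2 * (A * r u * B) i j + 1 / 2 * (A * x * B) i j := by
    rw [frameConnection, hqQ, ← hYQ, Matrix.mul_apply (M := Y), Finset.mul_sum]
    congr 1
    refine Finset.sum_congr rfl fun k _ => ?_
    rw [hYdef, Matrix.of_apply]
    ring
  rw [hl]
  simp only [Matrix.mul_apply, hx, Matrix.of_apply, Fin.sum_univ_three]
  ring

/-- In a normal frame, a tensor with the symmetries of the covariant derivative of the triple is
the one given by the connection matrix of the derivative `q` of `Q`. -/
theorem eq_sum_frameConnection (A : Matrix (Fin 3) (Fin 3) ℝ) (hA : A.det ^ 2 = 1)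
    (q : Fin 4 → Matrix (Fin 3) (Fin 3) ℝ) (K : Fin 3 → Fin 4 → Matrix (Fin 4) (Fin 4) ℝ)
    (W : Fin 3 → Matrix (Fin 4) (Fin 4) ℝ) (hW : ∀ i, W i = ∑ m, A i m • stdForm m)
    (hskew : ∀ i u, (K i u).transpose = -K i u)
    (hcliff : ∀ i j u, K i u * W j + W i * K j u + (K j u * W i + W j * K i u) =
      (-2 * (A.det * q u i j)) • (1 : Matrix (Fin 4) (Fin 4) ℝ))
    (hcyc : ∀ i u p q, K i u p q + K i p q u + K i q u p = 0)
    (htr : ∀ u, (A⁻¹ * q u * A⁻¹.transpose).trace = 0) (i : Fin 3) (u : Fin 4) :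
    K i u = ∑ j, frameConnection A q i j u • W j := by
  have hu : IsUnit A.det := by
    refine isUnit_iff_ne_zero.2 fun h0 => ?_
    simp [h0] at hA
  set B := A⁻¹ with hBdef
  have hAB : A * B = 1 := Matrix.mul_nonsing_inv A hu
  have hBA : B * A = 1 := Matrix.nonsing_inv_mul A hu
  set r : Fin 3 → Fin 3 → Fin 4 → ℝ := fun a b d => (A.det • (B * q d * B.transpose)) a b with hr
  have hS : ∀ j, stdForm j = ∑ m, B j m • W m := fun j => by
    simp only [hW, Finset.smul_sum, smul_smul]
    rw [Finset.sum_comm]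
    simp only [← Finset.sum_smul, ← Matrix.mul_apply, hBA, Matrix.one_apply, ite_smul, one_smul,
      zero_smul, Finset.sum_ite_eq, Finset.mem_univ, if_true]
  -- All relations are linear or bilinear in the index of the triple, so they pass to the
  -- combinations by `A⁻¹`, for which the triple is standard.
  have key := eq_sum_stdForm (fun i u => ∑ j, B i j • K j u) r
    (fun i u => by
      simp only [Matrix.transpose_sum, Matrix.transpose_smul, hskew, smul_neg,
        Finset.sum_neg_distrib])
    (fun i j u => by
      have h1 : r i j u = ∑ a, ∑ b, B i a * B j b * (A.det * q u a b) := by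
        simp only [hr, Matrix.smul_apply, smul_eq_mul, Matrix.mul_apply, Matrix.transpose_apply,
          Fin.sum_univ_three]
        ring
      have h2 : (-2 * r i j u) • (1 : Matrix (Fin 4) (Fin 4) ℝ) =
          ∑ a, ∑ b, (B i a * B j b) • (K a u * W b + W a * K b u + (K b u * W a + W b * K a u)) := by
        simp only [hcliff, smul_smul, ← Finset.sum_smul]
        congr 1
        rw [h1]
        simp only [Finset.mul_sum]
        refine Finset.sum_congr rfl fun _ _ => Finset.sum_congr rfl fun _ _ => by ring
      rw [h2, hS, hS]
      simp only [Fin.sum_univ_three, add_mul, mul_add, smul_mul_assoc, mul_smul_comm, smul_add,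
        smul_smul]
      module)
    (fun i u p q => by
      have h1 := hcyc 0 u p q
      have h2 := hcyc 1 u p q
      have h3 := hcyc 2 u p q
      simp only [Fin.sum_univ_three, Matrix.add_apply, Matrix.smul_apply, smul_eq_mul]
      linear_combination B i 0 * h1 + B i 1 * h2 + B i 2 * h3)
    (fun u => by
      have := htr u
      rw [Matrix.trace_fin_three] at this
      simp only [hr, Matrix.smul_apply, smul_eq_mul]
      linear_combination A.det * this)
  have hK : K i u = ∑ l, A i l • ∑ j, B l j • K j u := by
    simp only [Finset.smul_sum, smul_smul]
    rw [Finset.sum_comm]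
    simp only [← Finset.sum_smul, ← Matrix.mul_apply, hAB, Matrix.one_apply, ite_smul, one_smul,
      zero_smul, Finset.sum_ite_eq, Finset.mem_univ, if_true]
  rw [hK.trans (Finset.sum_congr rfl fun l _ => congrArg (A i l • ·) (key l u))]
  simp only [frameConnection_eq A B hA hAB, hS, ← hr]
  generalize (fun l m => 1 / 2 * r l m u + 1 / 2 * ∑ n, eps l m n * stdTau r n u) = c
  simp only [Fin.sum_univ_three]
  module

end Core

/-! ### Entrywise derivatives of matrices and of the Clifford relation -/

section Calculus

/-- The matrix valued function `M` has the derivative `M'` at `x`, entry by entry. -/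
def HasMatrixDerivAt {m n : ℕ} (M : ℝ → Matrix (Fin m) (Fin n) ℝ) (M' : Matrix (Fin m) (Fin n) ℝ)
    (x : ℝ) : Prop :=
  ∀ i j, HasDerivAt (fun t => M t i j) (M' i j) x

namespace HasMatrixDerivAt

variable {l m n : ℕ} {x : ℝ}

theorem mul {M : ℝ → Matrix (Fin l) (Fin m) ℝ} {N : ℝ → Matrix (Fin m) (Fin n) ℝ}
    {M' : Matrix (Fin l) (Fin m) ℝ} {N' : Matrix (Fin m) (Fin n) ℝ} (hM : HasMatrixDerivAt M M' x)
    (hN : HasMatrixDerivAt N N' x) :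
    HasMatrixDerivAt (fun t => M t * N t) (M' * N x + M x * N') x := by
  intro i j
  simp only [Matrix.mul_apply, Matrix.add_apply, ← Finset.sum_add_distrib]
  exact HasDerivAt.fun_sum fun k _ => (hM i k).mul (hN k j)

theorem add {M N : ℝ → Matrix (Fin m) (Fin n) ℝ} {M' N' : Matrix (Fin m) (Fin n) ℝ}
    (hM : HasMatrixDerivAt M M' x) (hN : HasMatrixDerivAt N N' x) :
    HasMatrixDerivAt (fun t => M t + N t) (M' + N') x :=
  fun i j => (hM i j).add (hN i j)

theorem smul {f : ℝ → ℝ} {f' : ℝ} {M : ℝ → Matrix (Fin m) (Fin n) ℝ}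
    {M' : Matrix (Fin m) (Fin n) ℝ} (hf : HasDerivAt f f' x) (hM : HasMatrixDerivAt M M' x) :
    HasMatrixDerivAt (fun t => f t • M t) (f' • M x + f x • M') x :=
  fun i j => hf.mul (hM i j)

theorem unique {M N : ℝ → Matrix (Fin m) (Fin n) ℝ} {M' N' : Matrix (Fin m) (Fin n) ℝ}
    (hM : HasMatrixDerivAt M M' x) (hN : HasMatrixDerivAt N N' x) (h : ∀ᶠ t in 𝓝 x, M t = N t) :
    M' = N' := by
  ext i j
  exact ((hM i j).congr_of_eventuallyEq (h.mono fun t ht => by simp [ht])).unique (hN i j) |>.symm ▸ rfl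

theorem differentiableAt_det {M : ℝ → Matrix (Fin n) (Fin n) ℝ}
    (hM : ∀ i j, DifferentiableAt ℝ (fun t => M t i j) x) :
    DifferentiableAt ℝ (fun t => (M t).det) x := by
  simp only [Matrix.det_apply']
  exact DifferentiableAt.fun_sum fun σ _ =>
    (DifferentiableAt.fun_finsetProd fun i _ => hM _ _).const_mul _

/-- Cramer's formula shows that the inverse is differentiable; its derivative is then read off from
`M M⁻¹ = 1`. -/
theorem inv {M : ℝ → Matrix (Fin n) (Fin n) ℝ} {M' : Matrix (Fin n) (Fin n) ℝ}
    (hM : HasMatrixDerivAt M M' x) (h1 : M x = 1) :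
    HasMatrixDerivAt (fun t => (M t)⁻¹) (-M') x := by
  have hd : ∀ i j, DifferentiableAt ℝ (fun t => M t i j) x := fun i j => (hM i j).differentiableAt
  have hdet := differentiableAt_det hd
  have h0 : (M x).det ≠ 0 := by simp [h1]
  have hI : ∀ i j, DifferentiableAt ℝ (fun t => (M t)⁻¹ i j) x := by
    intro i j
    simp only [Matrix.inv_def, Matrix.smul_apply, Ring.inverse_eq_inv, smul_eq_mul,
      Matrix.adjugate_apply]
    refine (hdet.inv h0).mul (differentiableAt_det fun k l => ?_)
    by_cases hk : k = j
    · subst hk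
      simp
    · simpa [Matrix.updateRow_ne hk] using hd k l
  set N' : Matrix (Fin n) (Fin n) ℝ := Matrix.of fun i j => deriv (fun t => (M t)⁻¹ i j) x with hN'
  have hN : HasMatrixDerivAt (fun t => (M t)⁻¹) N' x := fun i j => (hI i j).hasDerivAt
  have hc : HasMatrixDerivAt (fun _ => (1 : Matrix (Fin n) (Fin n) ℝ)) 0 x :=
    fun i j => hasDerivAt_const _ _
  have := (hM.mul hN).unique hc
    ((hdet.continuousAt.eventually_ne h0).mono fun t ht => Matrix.mul_nonsing_inv _ ht.isUnit)
  rw [h1, inv_one, mul_one, one_mul] at this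
  rwa [← eq_neg_of_add_eq_zero_right this]

/-- The derivative of the determinant of a family of constant determinant vanishes. -/
theorem trace_adjugate_mul {q : ℝ → Matrix (Fin 3) (Fin 3) ℝ} {q' : Matrix (Fin 3) (Fin 3) ℝ}
    (hq : HasMatrixDerivAt q q' x) (hdet : ∀ᶠ t in 𝓝 x, (q t).det ^ 2 = 1) :
    ((q x).adjugate * q').trace = 0 ∧ HasDerivAt (fun t => (q t).det) 0 x := by
  have h1 : HasDerivAt (fun t => (q t).det) (((q x).adjugate * q').trace) x := by
    simp only [Matrix.det_fin_three]
    have h : ∀ a b c d e f, HasDerivAt (fun t => q t a b * q t c d * q t e f)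
        ((q' a b * q x c d + q x a b * q' c d) * q x e f + q x a b * q x c d * q' e f) x :=
      fun a b c d e f => ((hq a b).mul (hq c d)).mul (hq e f)
    refine ((((((h 0 0 1 1 2 2).sub (h 0 0 1 2 2 1)).sub (h 0 1 1 0 2 2)).add
      (h 0 1 1 2 2 0)).add (h 0 2 1 0 2 1)).sub (h 0 2 1 1 2 0)).congr_deriv ?_
    rw [Matrix.trace_fin_three, Matrix.adjugate_fin_three]
    simp only [Matrix.mul_apply, Fin.sum_univ_three]
    simp
    ring
  -- Jacobi's formula combined with the derivative of the constant `(det q)² = 1`.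
  have h2 : 2 * (q x).det * ((q x).adjugate * q').trace = 0 := by
    have h3 := h1.pow 2
    have h4 := (h3.congr_of_eventuallyEq (f₁ := fun _ => (1 : ℝ))
      (hdet.mono fun t ht => by simp [ht])).unique (hasDerivAt_const x (1 : ℝ))
    simpa using h4
  have h5 : (q x).det ≠ 0 := fun h0 => by
    have := hdet.self_of_nhds
    simp [h0] at this
  have h6 : ((q x).adjugate * q').trace = 0 := by
    simpa [h5] using h2
  exact ⟨h6, h6 ▸ h1⟩

/-- The derivative of the Clifford relations at a point where the metric is standard. -/
theorem clifford {W : Fin 3 → ℝ → Matrix (Fin 4) (Fin 4) ℝ} {W' : Fin 3 → Matrix (Fin 4) (Fin 4) ℝ}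
    {G : ℝ → Matrix (Fin 4) (Fin 4) ℝ} {G' : Matrix (Fin 4) (Fin 4) ℝ}
    {q : ℝ → Matrix (Fin 3) (Fin 3) ℝ} {q' : Matrix (Fin 3) (Fin 3) ℝ}
    (hW : ∀ i, HasMatrixDerivAt (W i) (W' i) x) (hG : HasMatrixDerivAt G G' x)
    (hq : HasMatrixDerivAt q q' x) (hG1 : G x = 1) (hdet : ∀ᶠ t in 𝓝 x, (q t).det ^ 2 = 1)
    (hcl : ∀ᶠ t in 𝓝 x, ∀ i j, W i t * (G t)⁻¹ * W j t + W j t * (G t)⁻¹ * W i t =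
      (-2 * ((q t).det * q t i j)) • G t) (i j : Fin 3) :
    W' i * W j x - W i x * G' * W j x + W i x * W' j +
      (W' j * W i x - W j x * G' * W i x + W j x * W' i) =
      (-2 * (q x).det) • (q' i j • (1 : Matrix (Fin 4) (Fin 4) ℝ) + q x i j • G') := by
  have hI := hG.inv hG1
  have h1 : HasDerivAt (fun t => -2 * ((q t).det * q t i j)) (-2 * ((q x).det * q' i j)) x :=
    ((((hq.trace_adjugate_mul hdet).2.mul (hq i j))).const_mul (-2)).congr_deriv (by ring)
  have h2 := ((((hW i).mul hI).mul (hW j)).add (((hW j).mul hI).mul (hW i))).unique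
    (smul h1 hG) (hcl.mono fun t ht => ht i j)
  rw [hG1, inv_one] at h2
  simp only [mul_one, mul_neg, add_mul, neg_mul] at h2
  calc _ = _ := ?_
    _ = _ := h2
    _ = _ := ?_
  · simp only [← sub_eq_add_neg]
  · simp only [smul_add, smul_smul]
    congr 2 <;> ring

end HasMatrixDerivAt

end Calculus

/-! ### Differentiability of the induced volume, metric and `Q` -/

section Smoothness

variable {V : Type*} [AddCommGroup V] [Module ℝ V]
variable {E : Type*} [NormedAddCommGroup E] [NormedSpace ℝ E]
variable {η : E → Fin 3 → V [⋀^Fin 2]→ₗ[ℝ] ℝ} {z : E} {b e : Module.Basis (Fin 4) ℝ V}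
  {A : Matrix (Fin 3) (Fin 3) ℝ}

theorem differentiableAt_beta
    (hη : ∀ i v w, DifferentiableAt ℝ (fun y => η y i ![v, w]) z) (v w : V) (x : Fin 4 → V) :
    DifferentiableAt ℝ (fun y => beta (η y) v w x) z := by
  simp only [beta_apply]
  fun_prop

theorem differentiableAt_wedge
    (hη : ∀ i v w, DifferentiableAt ℝ (fun y => η y i ![v, w]) z) (i j : Fin 3) (x : Fin 4 → V) :
    DifferentiableAt ℝ (fun y => wedge (η y i) (η y j) x) z := by
  have h : ∀ y, wedge (η y i) (η y j) x = _ := fun y => wedge_two_two (η y i) (η y j) x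
  simp only [h]
  fun_prop

theorem IsNormalFrame.inducedVolume_apply_ne_zero {Ω : Fin 3 → V [⋀^Fin 2]→ₗ[ℝ] ℝ}
    (h : IsNormalFrame Ω e A) (b : Module.Basis (Fin 4) ℝ V) : inducedVolume b Ω b ≠ 0 := by
  rw [(h.induced_eq b).1]
  exact mul_ne_zero h.det_ne_zero (e.isUnit_det b).ne_zero

/-- In a normal frame the volume is nonzero, so the trace and the determinant of the matrix of `β`
do not vanish. Near the point the sign is constant, and the sixth root is taken away from zero. -/
theorem differentiableAt_inducedVolume
    (hη : ∀ i v w, DifferentiableAt ℝ (fun y => η y i ![v, w]) z) (h : IsNormalFrame (η z) e A)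
    (b : Module.Basis (Fin 4) ℝ V) :
    DifferentiableAt ℝ (fun y => inducedVolume b (η y) b) z := by
  have hne := h.inducedVolume_apply_ne_zero b
  simp only [inducedVolume, AlternatingMap.smul_apply, Module.Basis.det_self, smul_eq_mul,
    mul_one] at hne ⊢
  have hB : ∀ p q, DifferentiableAt ℝ (fun y => betaMatrix b (η y) p q) z := fun p q =>
    differentiableAt_beta hη _ _ _
  have htr : DifferentiableAt ℝ (fun y => (betaMatrix b (η y)).trace) z := by
    simp only [Matrix.trace, Matrix.diag]
    exact DifferentiableAt.fun_sum fun p _ => hB p p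
  have hdet : DifferentiableAt ℝ (fun y => (betaMatrix b (η y)).det) z := by
    simp only [Matrix.det_apply']
    fun_prop
  have htr0 : (betaMatrix b (η z)).trace ≠ 0 := fun h0 => hne (by simp [h0])
  have hdet0 : (betaMatrix b (η z)).det ≠ 0 := fun h0 => hne (by simp [h0])
  refine DifferentiableAt.mul ?_ ((hdet.abs hdet0).rpow_const (Or.inl (abs_ne_zero.2 hdet0)))
  rcases lt_or_gt_of_ne htr0 with hlt | hgt
  · exact (differentiableAt_const (-1 : ℝ)).congr_of_eventuallyEq
      ((htr.continuousAt.eventually_lt continuousAt_const hlt).mono fun y hy => Real.sign_of_neg hy)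
  · exact (differentiableAt_const (1 : ℝ)).congr_of_eventuallyEq
      ((continuousAt_const.eventually_lt htr.continuousAt hgt).mono fun y hy => Real.sign_of_pos hy)

theorem differentiableAt_inducedMetric
    (hη : ∀ i v w, DifferentiableAt ℝ (fun y => η y i ![v, w]) z) (h : IsNormalFrame (η z) e A)
    (b : Module.Basis (Fin 4) ℝ V) (v w : V) :
    DifferentiableAt ℝ (fun y => inducedMetric b (η y) v w) z := by
  simp only [inducedMetric, div_eq_mul_inv]
  exact (differentiableAt_beta hη v w b).fun_mul
    ((differentiableAt_inducedVolume hη h b).fun_inv (h.inducedVolume_apply_ne_zero b))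

theorem differentiableAt_inducedQ
    (hη : ∀ i v w, DifferentiableAt ℝ (fun y => η y i ![v, w]) z) (h : IsNormalFrame (η z) e A)
    (b : Module.Basis (Fin 4) ℝ V) (i j : Fin 3) :
    DifferentiableAt ℝ (fun y => inducedQ b (η y) i j) z := by
  simp only [inducedQ, Matrix.of_apply, div_eq_mul_inv]
  exact (differentiableAt_wedge hη i j b).fun_mul
    (((differentiableAt_inducedVolume hη h b).const_mul 2).fun_inv
      (mul_ne_zero two_ne_zero (h.inducedVolume_apply_ne_zero b)))

end Smoothness

/-! ### The covariant derivative of a closed triple in coordinates -/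

section Flat

variable {E : Type*} [NormedAddCommGroup E] [NormedSpace ℝ E]

/-- The triple of 2-covectors at the point `z` of a triple of forms on a vector space. -/
def flatTriple (w : Fin 3 → E → E [⋀^Fin 2]→L[ℝ] ℝ) (z : E) : Fin 3 → E [⋀^Fin 2]→ₗ[ℝ] ℝ :=
  fun i => (w i z).toAlternatingMap

/-- The covariant derivative of the form `w` at `z`, for the connection with the Christoffel symbols
`Γ`. -/
def flatCov (w : E → E [⋀^Fin 2]→L[ℝ] ℝ) (Γ : E → E →ₗ[ℝ] E) (z u v v' : E) : ℝ :=
  fderiv ℝ w z u ![v, v'] - w z ![Γ u v, v'] - w z ![v, Γ u v']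

theorem fderiv_cyclic_of_extDeriv_eq_zero {w : E → E [⋀^Fin 2]→L[ℝ] ℝ} {z : E}
    (h : extDeriv w z = 0) (u v v' : E) :
    fderiv ℝ w z u ![v, v'] + fderiv ℝ w z v ![v', u] + fderiv ℝ w z v' ![u, v] = 0 := by
  have h1 := congrArg (fun f => f ![u, v, v']) h
  simp only [extDeriv, ContinuousAlternatingMap.alternatizeUncurryFin_apply] at h1
  replace h1 := (Fin.sum_univ_three _).symm.trans h1
  have e0 : Fin.removeNth (0 : Fin 3) ![u, v, v'] = ![v, v'] := by
    ext i; fin_cases i <;> rfl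
  have e1 : Fin.removeNth (1 : Fin 3) ![u, v, v'] = ![u, v'] := by
    ext i; fin_cases i <;> rfl
  have e2 : Fin.removeNth (2 : Fin 3) ![u, v, v'] = ![u, v] := by
    ext i; fin_cases i <;> rfl
  rw [e0, e1, e2] at h1
  have h2 : fderiv ℝ w z v ![v', u] = -fderiv ℝ w z v ![u, v'] :=
    two_swap (fderiv ℝ w z v).toAlternatingMap v' u
  rw [h2]
  simp at h1
  linarith

variable {w : Fin 3 → E → E [⋀^Fin 2]→L[ℝ] ℝ} {z : E} {e : Module.Basis (Fin 4) ℝ E}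
  {A : Matrix (Fin 3) (Fin 3) ℝ} {Γ : E → E →ₗ[ℝ] E}

theorem two_add_left {V : Type*} [AddCommGroup V] [Module ℝ V] (η : V [⋀^Fin 2]→ₗ[ℝ] ℝ)
    (a b c : V) : η ![a + b, c] = η ![a, c] + η ![b, c] :=
  congrArg (fun f => f ![c]) (map_add η.curryLeft a b)

theorem two_smul_left {V : Type*} [AddCommGroup V] [Module ℝ V] (η : V [⋀^Fin 2]→ₗ[ℝ] ℝ)
    (r : ℝ) (a c : V) : η ![r • a, c] = r * η ![a, c] :=
  congrArg (fun f => f ![c]) (map_smul η.curryLeft r a)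

theorem two_add_right {V : Type*} [AddCommGroup V] [Module ℝ V] (η : V [⋀^Fin 2]→ₗ[ℝ] ℝ)
    (a b c : V) : η ![c, a + b] = η ![c, a] + η ![c, b] := by
  rw [two_swap η c, two_add_left, two_swap η c a, two_swap η c b, neg_add]

theorem two_smul_right {V : Type*} [AddCommGroup V] [Module ℝ V] (η : V [⋀^Fin 2]→ₗ[ℝ] ℝ)
    (r : ℝ) (a c : V) : η ![c, r • a] = r * η ![c, a] := by
  rw [two_swap η c, two_smul_left, two_swap η c a, mul_neg]

theorem flatCov_swap (w : E → E [⋀^Fin 2]→L[ℝ] ℝ) (u v v' : E) :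
    flatCov w Γ z u v v' = -flatCov w Γ z u v' v := by
  have h1 : ∀ (η : E [⋀^Fin 2]→L[ℝ] ℝ) (a b : E), η ![a, b] = -η ![b, a] := fun η a b =>
    two_swap η.toAlternatingMap a b
  rw [flatCov, flatCov, h1 _ v v', h1 _ (Γ u v) v', h1 _ v]
  ring

/-- Symmetric Christoffel terms cancel in pairs in the cyclic sum, leaving the exterior derivative.
-/
theorem flatCov_cyclic {w : E → E [⋀^Fin 2]→L[ℝ] ℝ} (h : extDeriv w z = 0)
    (hsymm : ∀ u v, Γ u v = Γ v u) (u v v' : E) :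
    flatCov w Γ z u v v' + flatCov w Γ z v v' u + flatCov w Γ z v' u v = 0 := by
  have h1 : ∀ (a b : E), w z ![a, b] = -w z ![b, a] := fun a b =>
    two_swap (w z).toAlternatingMap a b
  have h2 := fderiv_cyclic_of_extDeriv_eq_zero h u v v'
  rw [flatCov, flatCov, flatCov, hsymm v u, hsymm v' u, hsymm v' v, h1 v, h1 v', h1 u]
  linarith

/-- The derivative of the matrix of `w`, in terms of the covariant derivative. -/
theorem fderiv_apply_basis (w : E → E [⋀^Fin 2]→L[ℝ] ℝ) (e : Module.Basis (Fin 4) ℝ E) (u : E) :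
    Matrix.of (fun p q => fderiv ℝ w z u ![e p, e q]) =
      Matrix.of (fun p q => flatCov w Γ z u (e p) (e q)) +
        (Matrix.of fun m q => e.repr (Γ u (e q)) m).transpose *
          Matrix.of (fun p q => w z ![e p, e q]) +
        Matrix.of (fun p q => w z ![e p, e q]) * Matrix.of fun m q => e.repr (Γ u (e q)) m := by
  have h1 : ∀ v q, w z ![v, e q] = ∑ m, e.repr v m * w z ![e m, e q] := fun v q => by
    refine (two_apply_eq_sum (w z).toAlternatingMap e v (e q)).trans ?_
    simp [Finsupp.single_apply]
  have h2 : ∀ v p, w z ![e p, v] = ∑ m, w z ![e p, e m] * e.repr v m := fun v p => by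
    refine (two_apply_eq_sum (w z).toAlternatingMap e (e p) v).trans ?_
    simp [Finsupp.single_apply, mul_comm]
  ext p q
  simp only [Matrix.add_apply, Matrix.of_apply, Matrix.mul_apply, Matrix.transpose_apply, flatCov]
  rw [h1 (Γ u (e p)), h2 (Γ u (e q))]
  ring

theorem IsNormalFrame.det_inducedQ_sq {V : Type*} [AddCommGroup V] [Module ℝ V]
    {Ω : Fin 3 → V [⋀^Fin 2]→ₗ[ℝ] ℝ} {e : Module.Basis (Fin 4) ℝ V} (h : IsNormalFrame Ω e A)
    (b : Module.Basis (Fin 4) ℝ V) : (inducedQ b Ω).det ^ 2 = 1 := by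
  rw [h.det_inducedQ, h.det_sq]

theorem IsNormalFrame.det_inducedQ_mul {V : Type*} [AddCommGroup V] [Module ℝ V]
    {Ω : Fin 3 → V [⋀^Fin 2]→ₗ[ℝ] ℝ} {e : Module.Basis (Fin 4) ℝ V} (h : IsNormalFrame Ω e A)
    (b : Module.Basis (Fin 4) ℝ V) (i j : Fin 3) :
    (inducedQ b Ω).det * inducedQ b Ω i j = (A * A.transpose) i j := by
  rw [h.det_inducedQ, h.inducedQ_eq, Matrix.smul_apply, smul_eq_mul, ← mul_assoc, ← sq, h.det_sq,
    one_mul]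

theorem IsNormalFrame.gram_self {V : Type*} [AddCommGroup V] [Module ℝ V]
    {Ω : Fin 3 → V [⋀^Fin 2]→ₗ[ℝ] ℝ} {e : Module.Basis (Fin 4) ℝ V} (h : IsNormalFrame Ω e A) :
    gram e (inducedMetric e Ω) = 1 := by
  rw [(h.induced_eq e).2, gram_eq, Module.Basis.toMatrix_self, Matrix.transpose_one, one_mul]

/-- The covariant derivative of a closed triple, in a frame that is normal at the point. -/
theorem flatCov_eq (hw : ∀ i, DifferentiableAt ℝ (w i) z) (hclosed : ∀ i, extDeriv (w i) z = 0)
    (h : IsNormalFrame (flatTriple w z) e A)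
    (hev : ∀ᶠ y in 𝓝 z, ∃ e A, IsNormalFrame (flatTriple w y) e A)
    (hsymm : ∀ u v, Γ u v = Γ v u)
    (hmet : ∀ u v v', fderiv ℝ (fun y => inducedMetric e (flatTriple w y) v v') z u =
      inducedMetric e (flatTriple w z) (Γ u v) v' + inducedMetric e (flatTriple w z) v (Γ u v'))
    (i : Fin 3) (d : Fin 4) (v v' : E) :
    flatCov (w i) Γ z (e d) v v' = ∑ j, frameConnection A
      (fun d => Matrix.of fun i j => fderiv ℝ (fun y => inducedQ e (flatTriple w y) i j) z (e d))
      i j d * w j z ![v, v'] := by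
  set q : Fin 4 → Matrix (Fin 3) (Fin 3) ℝ := fun d =>
    Matrix.of fun i j => fderiv ℝ (fun y => inducedQ e (flatTriple w y) i j) z (e d) with hq
  set K : Fin 3 → Fin 4 → Matrix (Fin 4) (Fin 4) ℝ := fun i u =>
    Matrix.of fun p q => flatCov (w i) Γ z (e u) (e p) (e q) with hK
  set W : Fin 3 → Matrix (Fin 4) (Fin 4) ℝ := fun i => Matrix.of fun p q => w i z ![e p, e q] with hW
  have hη : ∀ i v v', DifferentiableAt ℝ (fun y => flatTriple w y i ![v, v']) z := fun i v v' =>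
    ((hw i).continuousAlternatingMap_apply_const ![v, v'])
  have hline : ∀ (u : E) (f : E → ℝ), DifferentiableAt ℝ f z →
      HasDerivAt (fun t : ℝ => f (z + t • u)) (fderiv ℝ f z u) 0 := fun u f hf =>
    hf.hasFDerivAt.hasLineDerivAt u
  -- Nearby normal frames carry no continuity. They only supply basis-independent identities along
  -- the line through `z`.
  have hev' : ∀ u : E, ∀ᶠ t : ℝ in 𝓝 0, ∃ e A, IsNormalFrame (flatTriple w (z + t • u)) e A := by
    intro u
    have hc : Filter.Tendsto (fun t : ℝ => z + t • u) (𝓝 0) (𝓝 z) := by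
      have : Continuous fun t : ℝ => z + t • u := by fun_prop
      simpa using this.tendsto 0
    exact hc.eventually hev
  have hqd : ∀ d, HasMatrixDerivAt (fun t : ℝ => inducedQ e (flatTriple w (z + t • e d))) (q d) 0 :=
    fun d i j => hline (e d) (fun y => inducedQ e (flatTriple w y) i j)
      (differentiableAt_inducedQ hη h e i j)
  have hdet : ∀ d, ∀ᶠ t : ℝ in 𝓝 0, (inducedQ e (flatTriple w (z + t • e d))).det ^ 2 = 1 :=
    fun d => (hev' (e d)).mono fun t ⟨_, _, ht⟩ => ht.det_inducedQ_sq e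
  have hcliff : ∀ i j u, K i u * W j + W i * K j u + (K j u * W i + W j * K i u) =
      (-2 * (A.det * q u i j)) • (1 : Matrix (Fin 4) (Fin 4) ℝ) := by
    intro i j u
    set T : Matrix (Fin 4) (Fin 4) ℝ := Matrix.of fun m q => e.repr (Γ (e u) (e q)) m with hT
    have hWd : ∀ i, HasMatrixDerivAt
        (fun t : ℝ => Matrix.of fun p q => flatTriple w (z + t • e u) i ![e p, e q])
        (K i u + T.transpose * W i + W i * T) 0 := by
      intro i
      rw [hK, hT, hW, ← fderiv_apply_basis (w i) e (e u)]
      intro p q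
      refine (hline (e u) (fun y => flatTriple w y i ![e p, e q]) (hη i _ _)).congr_deriv ?_
      exact fderiv_continuousAlternatingMap_apply_const_apply (hw i) _ _
    have hGd : HasMatrixDerivAt
        (fun t : ℝ => gram e (inducedMetric e (flatTriple w (z + t • e u))))
        (T.transpose + T) 0 := by
      intro p q
      refine (hline (e u) (fun y => inducedMetric e (flatTriple w y) (e p) (e q))
        (differentiableAt_inducedMetric hη h e _ _)).congr_deriv ?_
      rw [hmet, (h.induced_eq e).2]
      simp [hT, Finsupp.single_apply]
    have hc := HasMatrixDerivAt.clifford hWd hGd (hqd u)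
      (by simpa using h.gram_self) (hdet u) ((hev' (e u)).mono fun t ⟨_, _, ht⟩ i j => by
        rw [ht.det_inducedQ_mul e]
        exact ht.clifford e i j) i j
    have hS := h.clifford e i j
    rw [h.gram_self, inv_one, mul_one, mul_one] at hS
    simp only [zero_smul, add_zero] at hc
    rw [h.det_inducedQ] at hc
    have hWz : ∀ i, (Matrix.of fun p q => flatTriple w z i ![e p, e q]) = W i := fun i => rfl
    simp only [hWz] at hc hS
    have hS1 : W i * W j + W j * W i = (-2 * (A.det * inducedQ e (flatTriple w z) i j)) •
        (1 : Matrix (Fin 4) (Fin 4) ℝ) := by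
      rw [hS, ← h.det_inducedQ_mul e, h.det_inducedQ]
    have hS2 : T.transpose * (W i * W j + W j * W i) =
        (-2 * (A.det * inducedQ e (flatTriple w z) i j)) • T.transpose := by
      rw [hS1, mul_smul_comm, mul_one]
    have hS3 : (W i * W j + W j * W i) * T =
        (-2 * (A.det * inducedQ e (flatTriple w z) i j)) • T := by
      rw [hS1, smul_mul_assoc, one_mul]
    -- Substituting `W' = K + Tᵀ W + W T` and `G' = Tᵀ + T`, the inner Christoffel terms cancel. The
    -- outer ones `Tᵀ(…)` and `(…)T` are cancelled by the undifferentiated Clifford relation against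
    -- the `G'` term.
    calc _ = (-2 * A.det) • (q u i j • (1 : Matrix (Fin 4) (Fin 4) ℝ) +
          inducedQ e (flatTriple w z) i j • (T.transpose + T)) -
          T.transpose * (W i * W j + W j * W i) - (W i * W j + W j * W i) * T := by
          rw [← hc]; noncomm_ring
      _ = _ := by
          rw [hS2, hS3]; module
  have htr : ∀ u, (A⁻¹ * q u * A⁻¹.transpose).trace = 0 := by
    intro u
    have h1 := ((hqd u).trace_adjugate_mul (hdet u)).1
    simp only [zero_smul, add_zero] at h1
    have hAB : A * A⁻¹ = 1 := Matrix.mul_nonsing_inv A h.isUnit_det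
    -- Since `det Q · Q = A Aᵀ` and `(det Q)² = 1`, the adjugate in Jacobi's formula is `A⁻ᵀ A⁻¹`.
    have hQ : (inducedQ e (flatTriple w z)).adjugate = A⁻¹.transpose * A⁻¹ := by
      have hu : IsUnit (inducedQ e (flatTriple w z)).det := by
        rw [h.det_inducedQ]; exact h.isUnit_det
      have h2 : (inducedQ e (flatTriple w z)).adjugate =
          (inducedQ e (flatTriple w z)).det • (inducedQ e (flatTriple w z))⁻¹ := by
        rw [Matrix.inv_def, smul_smul, Ring.mul_inverse_cancel _ hu, one_smul]
      rw [h2, h.det_inducedQ, h.inducedQ_eq, inv_smul_mul_transpose A _ h.det_sq hAB, smul_smul,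
        ← sq, h.det_sq, one_smul]
    rw [hQ, Matrix.mul_assoc, Matrix.trace_mul_comm] at h1
    exact h1
  have key := eq_sum_frameConnection A h.det_sq q K W
    (fun i => by
      ext p q
      refine (h.apply_basis i p q).trans ?_
      simp [Matrix.sum_apply])
    (fun i u => by
      ext p q
      exact flatCov_swap (w i) (e u) (e q) (e p))
    hcliff (fun i u p q => flatCov_cyclic (hclosed i) hsymm (e u) (e p) (e q)) htr i d
  have hal : ∀ (η : E [⋀^Fin 2]→L[ℝ] ℝ) a b c, η ![a + b, c] = η ![a, c] + η ![b, c] :=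
    fun η => two_add_left η.toAlternatingMap
  have har : ∀ (η : E [⋀^Fin 2]→L[ℝ] ℝ) a b c, η ![c, a + b] = η ![c, a] + η ![c, b] :=
    fun η => two_add_right η.toAlternatingMap
  have hsl : ∀ (η : E [⋀^Fin 2]→L[ℝ] ℝ) (r : ℝ) a c, η ![r • a, c] = r * η ![a, c] :=
    fun η => two_smul_left η.toAlternatingMap
  have hsr : ∀ (η : E [⋀^Fin 2]→L[ℝ] ℝ) (r : ℝ) a c, η ![c, r • a] = r * η ![c, a] :=
    fun η => two_smul_right η.toAlternatingMap
  let B₁ : E →ₗ[ℝ] E →ₗ[ℝ] ℝ := LinearMap.mk₂ ℝ (fun v v' => flatCov (w i) Γ z (e d) v v')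
    (fun a b c => by simp only [flatCov, map_add, hal]; ring)
    (fun r a c => by simp only [flatCov, map_smul, hsl, smul_eq_mul]; ring)
    (fun c a b => by simp only [flatCov, map_add, har]; ring)
    (fun r c a => by simp only [flatCov, map_smul, hsr, smul_eq_mul]; ring)
  let B₂ : E →ₗ[ℝ] E →ₗ[ℝ] ℝ := LinearMap.mk₂ ℝ
    (fun v v' => ∑ j, frameConnection A q i j d * w j z ![v, v'])
    (fun a b c => by simp only [hal, mul_add, Finset.sum_add_distrib])
    (fun r a c => by
      simp only [hsl, smul_eq_mul, Finset.mul_sum]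
      exact Finset.sum_congr rfl fun _ _ => by ring)
    (fun c a b => by simp only [har, mul_add, Finset.sum_add_distrib])
    (fun r c a => by
      simp only [hsr, smul_eq_mul, Finset.mul_sum]
      exact Finset.sum_congr rfl fun _ _ => by ring)
  have hB : B₁ = B₂ := LinearMap.ext_basis e e fun p r => by
    have := congrFun (congrFun key p) r
    simpa [Matrix.sum_apply, hK, hW, B₁, B₂] using this
  exact congrArg (fun B => B v v') hB

end Flat

/-! ### Naturality under linear isomorphisms -/

section Transport

variable {V V' : Type*} [AddCommGroup V] [Module ℝ V] [AddCommGroup V'] [Module ℝ V']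
  {Ω : Fin 3 → V [⋀^Fin 2]→ₗ[ℝ] ℝ} {Ω' : Fin 3 → V' [⋀^Fin 2]→ₗ[ℝ] ℝ}
  {e : Module.Basis (Fin 4) ℝ V} {A : Matrix (Fin 3) (Fin 3) ℝ}

theorem IsNormalFrame.map (h : IsNormalFrame Ω e A) (T : V ≃ₗ[ℝ] V')
    (hT : ∀ i v w, Ω' i ![T v, T w] = Ω i ![v, w]) : IsNormalFrame Ω' (e.map T) A where
  det_sq := h.det_sq
  apply_basis i p q := by
    rw [Module.Basis.map_apply, Module.Basis.map_apply, hT, h.apply_basis]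

/-- An isomorphism carries a normal frame to one with the same `A`, and `A` alone determines `Q`.
This contains independence of the auxiliary basis. -/
theorem IsNormalFrame.inducedQ_map (h : IsNormalFrame Ω e A) (T : V ≃ₗ[ℝ] V')
    (hT : ∀ i v w, Ω' i ![T v, T w] = Ω i ![v, w]) (b : Module.Basis (Fin 4) ℝ V)
    (b' : Module.Basis (Fin 4) ℝ V') : inducedQ b' Ω' = inducedQ b Ω := by
  rw [(h.map T hT).inducedQ_eq, h.inducedQ_eq]

theorem IsNormalFrame.inducedMetric_map (h : IsNormalFrame Ω e A) (T : V ≃ₗ[ℝ] V')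
    (hT : ∀ i v w, Ω' i ![T v, T w] = Ω i ![v, w]) (b : Module.Basis (Fin 4) ℝ V)
    (b' : Module.Basis (Fin 4) ℝ V') (v w : V) :
    inducedMetric b' Ω' (T v) (T w) = inducedMetric b Ω v w := by
  rw [((h.map T hT).induced_eq b').2, (h.induced_eq b).2]
  simp

end Transport

/-! ### Coordinate vector fields -/

section CoordinateFields

variable {X : Type*} [TopologicalSpace X] [ChartedSpace E4 X]

/-- The coordinate vector field with constant components `a` in the chart at `x`. -/
def coordField (x : X) (a : E4) : (y : X) → TangentSpace (𝓡 4) y :=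
  fun y => (mfderiv (𝓡 4) 𝓘(ℝ, E4) (extChartAt (𝓡 4) x) y).inverse a

/-- A constant vector field on the model space. -/
def constField (a : E4) : (z : E4) → TangentSpace 𝓘(ℝ, E4) z := fun _ => a

theorem coordField_eq_mpullback (x : X) (a : E4) : coordField x a =
    VectorField.mpullback (𝓡 4) 𝓘(ℝ, E4) (extChartAt (𝓡 4) x) (constField a) :=
  rfl

theorem mdifferentiableAt_constField (a z : E4) :
    MDifferentiableAt 𝓘(ℝ, E4) (𝓘(ℝ, E4).prod 𝓘(ℝ, E4))
      (fun y => Bundle.TotalSpace.mk' E4 y (constField a y)) z := by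
  refine (mdifferentiableAt_section 𝓘(ℝ, E4) (F := E4) (E := TangentSpace 𝓘(ℝ, E4))
    (constField a)).2 ((mdifferentiableAt_const (c := a)).congr_of_eventuallyEq
      (Filter.Eventually.of_forall fun y => ?_))
  exact congrArg Prod.snd (trivializationAt_model_space_apply (I := 𝓘(ℝ, E4))
    (⟨y, constField a y⟩ : TangentBundle 𝓘(ℝ, E4) E4) z)

theorem coordField_add (x : X) (a b : E4) :
    coordField x (a + b) = coordField x a + coordField x b := by
  funext y
  exact map_add (mfderiv (𝓡 4) 𝓘(ℝ, E4) (extChartAt (𝓡 4) x) y).inverse a b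

theorem coordField_smul (x : X) (r : ℝ) (a : E4) :
    coordField x (r • a) = r • coordField x a := by
  funext y
  exact map_smul (mfderiv (𝓡 4) 𝓘(ℝ, E4) (extChartAt (𝓡 4) x) y).inverse r a

end CoordinateFields

/-! ### Charts, forms in charts and derivatives at the centre -/

section Charts

variable {X : Type*} [TopologicalSpace X] [ChartedSpace E4 X] [IsManifold (𝓡 4) ∞ X]

/-- The chart preferred at `x` also trivializes the tangent space at `x`, so its derivative there is
the identity of `E4`. -/
theorem coordField_self (x : X) (a : E4) : coordField x a x = a := by
  rw [coordField, mfderiv_extChartAt_self]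
  exact congrArg (fun L : E4 →L[ℝ] E4 => L a) ContinuousLinearMap.inverse_id

theorem diffAt_coordField (x : X) (a : E4) : DiffAt (coordField x a) x :=
  MDifferentiableAt.mpullback_vectorField (n := ∞) (I' := 𝓘(ℝ, E4))
    (mdifferentiableAt_constField a _) contMDiffAt_extChartAt
    (isInvertible_mfderiv_extChartAt (mem_extChartAt_source x)) (by norm_cast)

/-- Pullback commutes with the Lie bracket, and constant fields on the model commute. -/
theorem mlieBracket_coordField (x : X) (a b : E4) :
    VectorField.mlieBracket (𝓡 4) (coordField x a) (coordField x b) x = 0 := by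
  have : IsManifold (𝓡 4) (minSmoothness ℝ 3) X := by
    rw [minSmoothness_of_isRCLikeNormedField]
    exact IsManifold.of_le (n := ∞) (by norm_cast)
  rw [coordField_eq_mpullback, coordField_eq_mpullback, ← VectorField.mpullback_mlieBracket (n := ∞)
    (mdifferentiableAt_constField a _) (mdifferentiableAt_constField b _) contMDiffAt_extChartAt
    (by rw [minSmoothness_of_isRCLikeNormedField]; norm_cast),
    VectorField.mpullback_apply]
  have : VectorField.mlieBracket 𝓘(ℝ, E4) (constField a) (constField b) = 0 := by
    funext z
    rw [← VectorField.mlieBracketWithin_univ, VectorField.mlieBracketWithin_eq_lieBracketWithin]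
    change VectorField.lieBracketWithin ℝ (fun _ : E4 => a) (fun _ => b) Set.univ z = 0
    simp [VectorField.lieBracketWithin]
  rw [this]
  exact map_zero _

theorem coordField_symm_apply (x : X) {z : E4} (hz : z ∈ (extChartAt (𝓡 4) x).target) (a : E4) :
    coordField x a ((extChartAt (𝓡 4) x).symm z) =
      mfderiv 𝓘(ℝ, E4) (𝓡 4) (extChartAt (𝓡 4) x).symm z a := by
  have h1 := mfderivWithin_extChartAt_symm_comp_mfderiv_extChartAt (I := 𝓡 4) hz
  have h2 := mfderiv_extChartAt_comp_mfderivWithin_extChartAt_symm (I := 𝓡 4) hz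
  rw [modelWithCornersSelf_coe, Set.range_id, mfderivWithin_univ] at h1 h2
  exact congrArg (fun L => L a) (ContinuousLinearMap.inverse_eq h2 h1)

/-- The coordinate vector fields at a point of the chart, as an isomorphism. -/
theorem exists_coordField_equiv (x : X) {z : E4} (hz : z ∈ (extChartAt (𝓡 4) x).target) :
    ∃ T : E4 ≃ₗ[ℝ] TangentSpace (𝓡 4) ((extChartAt (𝓡 4) x).symm z),
      ∀ a, T a = coordField x a ((extChartAt (𝓡 4) x).symm z) := by
  obtain ⟨L, hL⟩ := isInvertible_mfderiv_extChartAt (I := 𝓡 4) ((extChartAt (𝓡 4) x).map_target hz)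
  refine ⟨L.symm.toLinearEquiv, fun a => ?_⟩
  rw [coordField, ← hL, ContinuousLinearMap.inverse_equiv]
  rfl

/-- The chart has identity derivative at its centre, so derivatives on the manifold there are
ordinary derivatives with no Jacobian factor. -/
theorem mdifferentiableAt_comp_extChartAt {x : X} {f : X → ℝ} {F : E4 → ℝ}
    (hF : DifferentiableAt ℝ F (extChartAt (𝓡 4) x x))
    (hf : ∀ᶠ y in 𝓝 x, f y = F (extChartAt (𝓡 4) x y)) :
    MDifferentiableAt (𝓡 4) 𝓘(ℝ, ℝ) f x ∧
      ∀ u : E4, mvfderiv (𝓡 4) f x u = fderiv ℝ F (extChartAt (𝓡 4) x x) u := by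
  have h1 : HasMFDerivAt (𝓡 4) 𝓘(ℝ, E4) (extChartAt (𝓡 4) x) x
      (ContinuousLinearMap.id ℝ (TangentSpace (𝓡 4) x)) := by
    rw [← mfderiv_extChartAt_self (I := 𝓡 4) (x := x)]
    exact (mdifferentiableAt_extChartAt (mem_chart_source E4 x)).hasMFDerivAt
  have h2 := (hF.hasFDerivAt.hasMFDerivAt.comp x h1).congr_of_eventuallyEq hf
  refine ⟨h2.mdifferentiableAt, fun u => ?_⟩
  rw [mvfderiv, h2.mfderiv]
  rfl

theorem inChart_apply (η : Form X 2) (x : X) {z : E4} (hz : z ∈ (extChartAt (𝓡 4) x).target)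
    (a b : E4) :
    η.inChart x z ![a, b] = η ((extChartAt (𝓡 4) x).symm z)
      ![coordField x a ((extChartAt (𝓡 4) x).symm z),
        coordField x b ((extChartAt (𝓡 4) x).symm z)] := by
  rw [coordField_symm_apply x hz, coordField_symm_apply x hz]
  refine congrArg (η ((extChartAt (𝓡 4) x).symm z)) (funext fun i => ?_)
  fin_cases i <;> rfl

theorem inChart_extChartAt (η : Form X 2) {x y : X} (hy : y ∈ (extChartAt (𝓡 4) x).source)
    (a b : E4) : η.inChart x (extChartAt (𝓡 4) x y) ![a, b] =
      η y ![coordField x a y, coordField x b y] := by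
  have := inChart_apply η x ((extChartAt (𝓡 4) x).map_source hy) a b
  rwa [(extChartAt (𝓡 4) x).left_inv hy] at this

theorem inChart_self (η : Form X 2) (x : X) (a b : E4) :
    η.inChart x (extChartAt (𝓡 4) x x) ![a, b] = η x ![a, b] := by
  rw [inChart_extChartAt η (mem_extChartAt_source x), coordField_self, coordField_self]

end Charts

section Charts

variable {X : Type*} [TopologicalSpace X] [ChartedSpace E4 X]

theorem Form.IsSmooth.differentiableAt {k : ℕ} {η : Form X k} (hη : η.IsSmooth) (x : X) {z : E4}
    (hz : z ∈ (extChartAt (𝓡 4) x).target) : DifferentiableAt ℝ (η.inChart x) z :=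
  ((hη x).contDiffAt ((isOpen_extChartAt_target x).mem_nhds hz)).differentiableAt (by simp)

theorem eventually_mem_extChartAt_source (x : X) :
    ∀ᶠ y in 𝓝 x, y ∈ (extChartAt (𝓡 4) x).source :=
  extChartAt_source_mem_nhds x

end Charts

/-! ### Tensoriality of the covariant derivative of a 2-form -/

section Tensoriality

variable {X : Type*} [TopologicalSpace X] [ChartedSpace E4 X] [IsManifold (𝓡 4) ∞ X]

/-- The components of a vector field in the chart at `x`. -/
def components (x : X) (V : (y : X) → TangentSpace (𝓡 4) y) (y : X) : E4 :=
  mfderiv (𝓡 4) 𝓘(ℝ, E4) (extChartAt (𝓡 4) x) y (V y)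

theorem coordField_components (x : X) (V : (y : X) → TangentSpace (𝓡 4) y) {y : X}
    (hy : y ∈ (extChartAt (𝓡 4) x).source) : coordField x (components x V y) y = V y := by
  obtain ⟨L, hL⟩ := isInvertible_mfderiv_extChartAt (I := 𝓡 4) hy
  rw [coordField, components, ← hL, ContinuousLinearMap.inverse_equiv]
  exact L.symm_apply_apply (V y)

theorem mdifferentiableAt_components {x : X} {V : (y : X) → TangentSpace (𝓡 4) y}
    (hV : DiffAt V x) : MDifferentiableAt (𝓡 4) 𝓘(ℝ, E4) (components x V) x := by
  refine ((mdifferentiableAt_section (𝓡 4) V).1 hV).congr_of_eventuallyEq ?_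
  filter_upwards [eventually_mem_extChartAt_source x] with y hy
  rw [extChartAt_source] at hy
  rw [components, ← TangentBundle.continuousLinearMapAt_trivializationAt hy]
  have hb : y ∈ (trivializationAt E4 (TangentSpace (𝓡 4)) x).baseSet := hy
  exact congrFun (Bundle.Trivialization.coe_linearMapAt_of_mem (R := ℝ) _ hb) (V y)

theorem mdifferentiableAt_form_apply {η : Form X 2} (hη : η.IsSmooth) {x : X}
    {V W : (y : X) → TangentSpace (𝓡 4) y} (hV : DiffAt V x) (hW : DiffAt W x) :
    MDifferentiableAt (𝓡 4) 𝓘(ℝ, ℝ) (fun y => η y ![V y, W y]) x := by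
  set b : Module.Basis (Fin 4) ℝ E4 := (EuclideanSpace.basisFun (Fin 4) ℝ).toBasis
  have hc : ∀ {V : (y : X) → TangentSpace (𝓡 4) y}, DiffAt V x → ∀ p : Fin 4,
      MDifferentiableAt (𝓡 4) 𝓘(ℝ, ℝ) (fun y => components x V y p) x := fun hV p =>
    ((EuclideanSpace.proj (𝕜 := ℝ) p).differentiableAt.mdifferentiableAt).comp x
      (mdifferentiableAt_components hV)
  have hw : ∀ p q, MDifferentiableAt (𝓡 4) 𝓘(ℝ, ℝ)
      (fun y => η.inChart x (extChartAt (𝓡 4) x y) ![b p, b q]) x := fun p q =>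
    (mdifferentiableAt_comp_extChartAt
      ((hη.differentiableAt x (mem_extChartAt_target x)).continuousAlternatingMap_apply_const _)
      (Filter.Eventually.of_forall fun y => rfl)).1
  have h : MDifferentiableAt (𝓡 4) 𝓘(ℝ, ℝ) (∑ p, ∑ q, fun y => components x V y p *
      components x W y q * η.inChart x (extChartAt (𝓡 4) x y) ![b p, b q]) x :=
    MDifferentiableAt.sum fun p _ => MDifferentiableAt.sum fun q _ =>
      ((hc hV p).mul (hc hW q)).mul (hw p q)
  refine h.congr_of_eventuallyEq ?_
  filter_upwards [eventually_mem_extChartAt_source x] with y hy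
  have h1 := inChart_extChartAt η hy (components x V y) (components x W y)
  rw [coordField_components x V hy, coordField_components x W hy] at h1
  rw [← h1]
  refine (two_apply_eq_sum (η.inChart x (extChartAt (𝓡 4) x y)).toAlternatingMap b _ _).trans ?_
  simp only [Finset.sum_apply]
  rfl

variable {cov : CovariantDerivative (𝓡 4) E4 (TangentSpace (𝓡 4) : X → Type _)}

theorem covTwoForm_swap (η : Form X 2) (x : X) (u : TangentSpace (𝓡 4) x)
    (V W : (y : X) → TangentSpace (𝓡 4) y) :
    covTwoForm cov η x u V W = -covTwoForm cov η x u W V := by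
  have h1 : ∀ (y : X) (a b : TangentSpace (𝓡 4) y), η y ![a, b] = -η y ![b, a] := fun y a b =>
    two_swap (η y).toAlternatingMap a b
  have h2 : (fun y => η y ![V y, W y]) = -fun y => η y ![W y, V y] := funext fun y => h1 y _ _
  rw [covTwoForm, covTwoForm, h2, mvfderiv_neg, h1 x (cov V x u), h1 x (V x)]
  simp
  ring

/-- The derivative of `f` in the product rule for `η(fV, W)` cancels against the Leibniz term of
`∇(fV)`. Smoothness of `η` makes that product rule available. -/
theorem tensorialAt_covTwoForm_left {η : Form X 2} (hη : η.IsSmooth) (x : X)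
    (u : TangentSpace (𝓡 4) x) {W : (y : X) → TangentSpace (𝓡 4) y} (hW : DiffAt W x) :
    TensorialAt (𝓡 4) E4 (fun V => covTwoForm cov η x u V W) x where
  smul {f V} hf hV := by
    have hs : ∀ (y : X) (r : ℝ) (a b : TangentSpace (𝓡 4) y), η y ![r • a, b] = r * η y ![a, b] :=
      fun y => two_smul_left (η y).toAlternatingMap
    have ha : ∀ (y : X) (a b c : TangentSpace (𝓡 4) y), η y ![a + b, c] = η y ![a, c] + η y ![b, c] :=
      fun y => two_add_left (η y).toAlternatingMap
    have h1 : (fun y => η y ![(f • V) y, W y]) = f * fun y => η y ![V y, W y] :=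
      funext fun y => hs y (f y) (V y) (W y)
    have h2 := cov.isCovariantDerivativeOnUniv.leibniz hV hf
    have h3 : cov (f • V) x u = f x • cov V x u + mvfderiv (𝓡 4) f x u • V x :=
      congrArg (fun L => L u) h2
    have h4 := mvfderiv_mul hf (mdifferentiableAt_form_apply hη hV hW)
    have h5 : mvfderiv (𝓡 4) (f * fun y => η y ![V y, W y]) x u =
        f x * mvfderiv (𝓡 4) (fun y => η y ![V y, W y]) x u + η x ![V x, W x] * mvfderiv (𝓡 4) f x u :=
      congrArg (fun L => L u) h4
    have h6 : (f • V) x = f x • V x := rfl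
    simp only [covTwoForm, smul_eq_mul]
    rw [h1, h5, h3, h6, ha, hs, hs, hs]
    ring
  add {V V'} hV hV' := by
    have ha : ∀ (y : X) (a b c : TangentSpace (𝓡 4) y), η y ![a + b, c] = η y ![a, c] + η y ![b, c] :=
      fun y => two_add_left (η y).toAlternatingMap
    have h1 : (fun y => η y ![(V + V') y, W y]) =
        (fun y => η y ![V y, W y]) + fun y => η y ![V' y, W y] :=
      funext fun y => ha y (V y) (V' y) (W y)
    have h3 : cov (V + V') x u = cov V x u + cov V' x u :=
      congrArg (fun L => L u) (cov.isCovariantDerivativeOnUniv.add hV hV')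
    have h5 : mvfderiv (𝓡 4) ((fun y => η y ![V y, W y]) + fun y => η y ![V' y, W y]) x u =
        mvfderiv (𝓡 4) (fun y => η y ![V y, W y]) x u + mvfderiv (𝓡 4) (fun y => η y ![V' y, W y]) x u :=
      congrArg (fun L => L u) (mvfderiv_add (mdifferentiableAt_form_apply hη hV hW)
        (mdifferentiableAt_form_apply hη hV' hW))
    have h6 : (V + V') x = V x + V' x := rfl
    simp only [covTwoForm]
    rw [h1, h5, h3, h6, ha, ha]
    ring

theorem tensorialAt_covTwoForm_right {η : Form X 2} (hη : η.IsSmooth) (x : X)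
    (u : TangentSpace (𝓡 4) x) {V : (y : X) → TangentSpace (𝓡 4) y} (hV : DiffAt V x) :
    TensorialAt (𝓡 4) E4 (fun W => covTwoForm cov η x u V W) x where
  smul hf hW := by
    rw [covTwoForm_swap, (tensorialAt_covTwoForm_left hη x u hV).smul hf hW,
      covTwoForm_swap η x u V, smul_neg]
  add hW hW' := by
    rw [covTwoForm_swap, (tensorialAt_covTwoForm_left hη x u hV).add hW hW',
      covTwoForm_swap η x u V, covTwoForm_swap η x u V, neg_add]

/-- The covariant derivative of a form depends on the values of the vector fields only. -/
theorem covTwoForm_eq_coordField {η : Form X 2} (hη : η.IsSmooth) (x : X)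
    (u : TangentSpace (𝓡 4) x) {V W : (y : X) → TangentSpace (𝓡 4) y} (hV : DiffAt V x)
    (hW : DiffAt W x) :
    covTwoForm cov η x u V W = covTwoForm cov η x u (coordField x (V x)) (coordField x (W x)) :=
  TensorialAt.pointwise₂ (I := 𝓡 4) (F := E4) (F' := E4)
    (Φ := fun V W => covTwoForm cov η x u V W)
    (fun _ h => tensorialAt_covTwoForm_left hη x u h)
    (fun _ h => tensorialAt_covTwoForm_right hη x u h) hV (diffAt_coordField x _) hW
    (diffAt_coordField x _) (coordField_self x _).symm (coordField_self x _).symm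

end Tensoriality

/-! ### The connection form in a normal frame and the framing of `Λ⁺` -/

section Charts

variable {X : Type*} [TopologicalSpace X] [ChartedSpace E4 X]

/-- The right hand side of the formula for the connection matrix. -/
def connectionForm (Ω : Fin 3 → Form X 2) (i j : Fin 3) (x : X) :
    TangentSpace (𝓡 4) x →ₗ[ℝ] ℝ :=
  (1 / 2 : ℝ) • dQQinv Ω i j x + ∑ k, (Q Ω x)⁻¹ k j • matX Ω i k x

theorem linear_sum_apply {V : Type*} [AddCommGroup V] [Module ℝ V] {n : ℕ}
    (f : Fin n → V →ₗ[ℝ] ℝ) (v : V) : (∑ i, f i) v = ∑ i, f i v :=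
  LinearMap.sum_apply _ _ _

/-- The connection form in a normal frame. -/
theorem connectionForm_apply_basis (Ω : Fin 3 → Form X 2) (x : X)
    {e : Module.Basis (Fin 4) ℝ (TangentSpace (𝓡 4) x)} {A : Matrix (Fin 3) (Fin 3) ℝ}
    (h : IsNormalFrame (tripleAt Ω x) e A) (i j : Fin 3) (d : Fin 4) :
    connectionForm Ω i j x (e d) =
      frameConnection A (fun d => Matrix.of fun i j => dQ Ω i j x (e d)) i j d := by
  set q : Fin 4 → Matrix (Fin 3) (Fin 3) ℝ := fun d => Matrix.of fun i j => dQ Ω i j x (e d) with hq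
  have hQ : Q Ω x = A.det • (A * A.transpose) := h.inducedQ_eq (frame x)
  have h1 : ∀ i j d, dQQinv Ω i j x (e d) = (q d * (A.det • (A * A.transpose))⁻¹) i j := by
    intro i j d
    rw [dQQinv, linear_sum_apply, Matrix.mul_apply, hQ]
    refine Finset.sum_congr rfl fun k _ => ?_
    rw [LinearMap.smul_apply, smul_eq_mul, mul_comm]
    rfl
  have h2 : ∀ i d, tau Ω i x (e d) = frameTau A q i d := by
    intro i d
    rw [tau, LinearMap.neg_apply, linear_sum_apply, frameTau]
    congr 1
    refine Finset.sum_congr rfl fun k _ => ?_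
    rw [h.opE_apply_basis]
    simp only [h1]
  have h3 : ∀ i k, matX Ω i k x (e d) = 1 / 2 * ∑ l, ∑ m, eps i k l *
      (A.det • (A * A.transpose))⁻¹ l m * frameTau A q m d := by
    intro i k
    rw [matX, LinearMap.smul_apply, linear_sum_apply, smul_eq_mul]
    congr 1
    refine Finset.sum_congr rfl fun l _ => ?_
    rw [linear_sum_apply]
    refine Finset.sum_congr rfl fun m _ => ?_
    rw [LinearMap.smul_apply, smul_eq_mul, h2, hQ]
  rw [connectionForm, frameConnection, LinearMap.add_apply, LinearMap.smul_apply, linear_sum_apply,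
    h1, smul_eq_mul]
  congr 1
  refine Finset.sum_congr rfl fun k _ => ?_
  rw [LinearMap.smul_apply, smul_eq_mul, h3, hQ]

variable {o : (x : X) → Orientation ℝ (TangentSpace (𝓡 4) x) (Fin 4)} {Ω : Fin 3 → Form X 2}

theorem IsHypersymplectic.exists_isNormalFrame (hΩ : IsHypersymplectic o Ω) (x : X) :
    ∃ e A, IsNormalFrame (tripleAt Ω x) e A ∧ e.orientation = o x :=
  Hypersymplectic.exists_isNormalFrame (o x) (frame x) (tripleAt Ω x) (hΩ.posDef x)

theorem IsHypersymplectic.isFramingOfSelfDual (hΩ : IsHypersymplectic o Ω) :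
    IsFramingOfSelfDual o Ω := by
  intro x
  obtain ⟨e, A, h, ho⟩ := hΩ.exists_isNormalFrame x
  refine ⟨h.linearIndependent, fun η => ?_⟩
  rw [h.mem_span_iff, ← ho]
  exact (h.isSelfDual_iff (frame x) η).symm

end Charts

/-! ### The Levi-Civita connection on the manifold -/

section Connection

variable {X : Type*} [TopologicalSpace X] [ChartedSpace E4 X] [IsManifold (𝓡 4) ∞ X]

/-- The triple in the chart at `x`. -/
def chartTriple (Ω : Fin 3 → Form X 2) (x : X) (i : Fin 3) : E4 → E4 [⋀^Fin 2]→L[ℝ] ℝ :=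
  (Ω i).inChart x

/-- The Christoffel symbols at `x`, in the chart at `x`. -/
def christoffel (cov : CovariantDerivative (𝓡 4) E4 (TangentSpace (𝓡 4) : X → Type _)) (x : X)
    (u : E4) : E4 →ₗ[ℝ] E4 where
  toFun a := cov (coordField x a) x u
  map_add' a b := by
    rw [coordField_add]
    exact congrArg (fun L => L u) (cov.isCovariantDerivativeOnUniv.add (diffAt_coordField x a)
      (diffAt_coordField x b))
  map_smul' r a := by
    rw [coordField_smul]
    exact congrArg (fun L => L u)
      (cov.isCovariantDerivativeOnUniv.smul_const r (diffAt_coordField x a))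

variable {cov : CovariantDerivative (𝓡 4) E4 (TangentSpace (𝓡 4) : X → Type _)}

/-- Coordinate fields commute, so the bracket term of the torsion drops out. -/
theorem christoffel_symm (h : cov.torsion = 0) (x : X) (u v : E4) :
    christoffel cov x u v = christoffel cov x v u := by
  have h1 := (CovariantDerivative.torsion_eq_zero_iff cov).1 h (diffAt_coordField x u)
    (diffAt_coordField x v)
  rw [mlieBracket_coordField, sub_eq_zero, coordField_self, coordField_self] at h1
  exact h1

theorem covTwoForm_coordField {η : Form X 2} (hη : η.IsSmooth) (x : X) (u a b : E4) :
    covTwoForm cov η x u (coordField x a) (coordField x b) =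
      flatCov (η.inChart x) (christoffel cov x) (extChartAt (𝓡 4) x x) u a b := by
  have hd := hη.differentiableAt x (mem_extChartAt_target x)
  have h1 := (mdifferentiableAt_comp_extChartAt (f := fun y => η y ![coordField x a y, coordField x b y])
    (hd.continuousAlternatingMap_apply_const ![a, b])
    ((eventually_mem_extChartAt_source x).mono fun y hy => (inChart_extChartAt η hy a b).symm)).2 u
  have h2 : mvfderiv (𝓡 4) (fun y => η y ![coordField x a y, coordField x b y]) x u =
      fderiv ℝ (η.inChart x) (extChartAt (𝓡 4) x x) u ![a, b] :=
    h1.trans (fderiv_continuousAlternatingMap_apply_const_apply hd _ _)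
  have h3 : η x ![cov (coordField x a) x u, coordField x b x] =
      η.inChart x (extChartAt (𝓡 4) x x) ![christoffel cov x u a, b] := by
    rw [inChart_self, coordField_self]
    rfl
  have h4 : η x ![coordField x a x, cov (coordField x b) x u] =
      η.inChart x (extChartAt (𝓡 4) x x) ![a, christoffel cov x u b] := by
    rw [inChart_self, coordField_self]
    rfl
  exact congrArg₂ (· - ·) (congrArg₂ (· - ·) h2 h3) h4

variable {o : (x : X) → Orientation ℝ (TangentSpace (𝓡 4) x) (Fin 4)} {Ω : Fin 3 → Form X 2}

theorem flatTriple_chartTriple_apply (Ω : Fin 3 → Form X 2) (x : X) {z : E4}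
    (hz : z ∈ (extChartAt (𝓡 4) x).target) (i : Fin 3) (a b : E4) :
    tripleAt Ω ((extChartAt (𝓡 4) x).symm z) i
      ![coordField x a ((extChartAt (𝓡 4) x).symm z), coordField x b ((extChartAt (𝓡 4) x).symm z)] =
      flatTriple (chartTriple Ω x) z i ![a, b] :=
  (inChart_apply (Ω i) x hz a b).symm

theorem IsHypersymplectic.exists_flat_isNormalFrame (hΩ : IsHypersymplectic o Ω) (x : X) {z : E4}
    (hz : z ∈ (extChartAt (𝓡 4) x).target) :
    ∃ e A, IsNormalFrame (flatTriple (chartTriple Ω x) z) e A := by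
  obtain ⟨e, A, h, -⟩ := hΩ.exists_isNormalFrame ((extChartAt (𝓡 4) x).symm z)
  obtain ⟨T, hT⟩ := exists_coordField_equiv x hz
  refine ⟨e.map T.symm, A, h.map T.symm fun i v w => ?_⟩
  rw [← flatTriple_chartTriple_apply Ω x hz, ← hT, ← hT, T.apply_symm_apply, T.apply_symm_apply]

theorem IsHypersymplectic.Q_symm_apply (hΩ : IsHypersymplectic o Ω) (x : X) {z : E4}
    (hz : z ∈ (extChartAt (𝓡 4) x).target) (b : Module.Basis (Fin 4) ℝ E4) :
    Q Ω ((extChartAt (𝓡 4) x).symm z) = inducedQ b (flatTriple (chartTriple Ω x) z) := by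
  obtain ⟨e, A, h⟩ := hΩ.exists_flat_isNormalFrame x hz
  obtain ⟨T, hT⟩ := exists_coordField_equiv x hz
  refine h.inducedQ_map T (fun i v w => ?_) b _
  rw [hT, hT, flatTriple_chartTriple_apply Ω x hz]

theorem IsHypersymplectic.metric_symm_apply (hΩ : IsHypersymplectic o Ω) (x : X) {z : E4}
    (hz : z ∈ (extChartAt (𝓡 4) x).target) (b : Module.Basis (Fin 4) ℝ E4) (v w : E4) :
    Hypersymplectic.metric Ω ((extChartAt (𝓡 4) x).symm z)
        (coordField x v ((extChartAt (𝓡 4) x).symm z))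
        (coordField x w ((extChartAt (𝓡 4) x).symm z)) =
      inducedMetric b (flatTriple (chartTriple Ω x) z) v w := by
  obtain ⟨e, A, h⟩ := hΩ.exists_flat_isNormalFrame x hz
  obtain ⟨T, hT⟩ := exists_coordField_equiv x hz
  rw [← hT, ← hT]
  refine h.inducedMetric_map T (fun i v w => ?_) b _ v w
  rw [hT, hT, flatTriple_chartTriple_apply Ω x hz]

theorem IsHypersymplectic.Q_eq (hΩ : IsHypersymplectic o Ω) {x y : X}
    (hy : y ∈ (extChartAt (𝓡 4) x).source) (b : Module.Basis (Fin 4) ℝ E4) :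
    Q Ω y = inducedQ b (flatTriple (chartTriple Ω x) (extChartAt (𝓡 4) x y)) := by
  have := hΩ.Q_symm_apply x ((extChartAt (𝓡 4) x).map_source hy) b
  rwa [(extChartAt (𝓡 4) x).left_inv hy] at this

theorem IsHypersymplectic.metric_eq (hΩ : IsHypersymplectic o Ω) {x y : X}
    (hy : y ∈ (extChartAt (𝓡 4) x).source) (b : Module.Basis (Fin 4) ℝ E4) (v w : E4) :
    Hypersymplectic.metric Ω y (coordField x v y) (coordField x w y) =
      inducedMetric b (flatTriple (chartTriple Ω x) (extChartAt (𝓡 4) x y)) v w := by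
  have := hΩ.metric_symm_apply x ((extChartAt (𝓡 4) x).map_source hy) b v w
  rwa [(extChartAt (𝓡 4) x).left_inv hy] at this

/-- The covariant derivative of the triple along a vector of a normal frame. -/
theorem IsHypersymplectic.covTwoForm_basis (hΩ : IsHypersymplectic o Ω)
    (hcov : IsLeviCivita (Hypersymplectic.metric Ω) cov) (x : X)
    {e : Module.Basis (Fin 4) ℝ (TangentSpace (𝓡 4) x)} {A : Matrix (Fin 3) (Fin 3) ℝ}
    (h : IsNormalFrame (tripleAt Ω x) e A) (i : Fin 3) (d : Fin 4) (v v' : E4) :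
    covTwoForm cov (Ω i) x (e d) (coordField x v) (coordField x v') =
      ∑ j, connectionForm Ω i j x (e d) * Ω j x ![v, v'] := by
  -- The tangent space at `x` is `E4` by definition, and the chart is the identity to first order at
  -- `x`, so the frame is also normal for the triple in the chart.
  let b : Module.Basis (Fin 4) ℝ E4 := e
  have hx := mem_extChartAt_target (I := 𝓡 4) x
  have h0 : ∀ i (a b : E4), flatTriple (chartTriple Ω x) (extChartAt (𝓡 4) x x) i ![a, b] =
      Ω i x ![a, b] := fun i => inChart_self (Ω i) x
  have hb : IsNormalFrame (flatTriple (chartTriple Ω x) (extChartAt (𝓡 4) x x)) b A :=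
    ⟨h.det_sq, fun i p q => (h0 i _ _).trans (h.apply_basis i p q)⟩
  have hw : ∀ i, DifferentiableAt ℝ (chartTriple Ω x i) (extChartAt (𝓡 4) x x) := fun i =>
    (hΩ.smooth i).differentiableAt x hx
  have hη : ∀ i v v', DifferentiableAt ℝ (fun y => flatTriple (chartTriple Ω x) y i ![v, v'])
      (extChartAt (𝓡 4) x x) := fun i v v' => (hw i).continuousAlternatingMap_apply_const ![v, v']
  have hmet : ∀ u v v' : E4,
      fderiv ℝ (fun y => inducedMetric b (flatTriple (chartTriple Ω x) y) v v')
        (extChartAt (𝓡 4) x x) u =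
      inducedMetric b (flatTriple (chartTriple Ω x) (extChartAt (𝓡 4) x x)) (christoffel cov x u v) v' +
      inducedMetric b (flatTriple (chartTriple Ω x) (extChartAt (𝓡 4) x x)) v
        (christoffel cov x u v') := by
    intro u v v'
    have h1 := (mdifferentiableAt_comp_extChartAt
      (f := fun y => Hypersymplectic.metric Ω y (coordField x v y) (coordField x v' y))
      (differentiableAt_inducedMetric hη hb b v v')
      ((eventually_mem_extChartAt_source x).mono fun y hy => hΩ.metric_eq hy b v v')).2 u
    have h2 := hcov.metric x _ _ (diffAt_coordField x v) (diffAt_coordField x v') u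
    have h3 : ∀ v w : E4, Hypersymplectic.metric Ω x v w =
        inducedMetric b (flatTriple (chartTriple Ω x) (extChartAt (𝓡 4) x x)) v w := fun v w => by
      have := hΩ.metric_eq (mem_extChartAt_source x) b v w
      rwa [coordField_self, coordField_self] at this
    rw [← h1, h2, coordField_self, coordField_self, ← h3, ← h3]
    rfl
  have hq : ∀ d i j, fderiv ℝ (fun y => inducedQ b (flatTriple (chartTriple Ω x) y) i j)
      (extChartAt (𝓡 4) x x) (b d) = dQ Ω i j x (e d) := fun d i j =>
    ((mdifferentiableAt_comp_extChartAt (f := fun y => Q Ω y i j)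
      (differentiableAt_inducedQ hη hb b i j)
      ((eventually_mem_extChartAt_source x).mono fun y hy => by rw [hΩ.Q_eq hy b])).2 (b d)).symm
  have key := flatCov_eq hw (fun i => hΩ.closed i x _ hx) hb
    (Filter.eventually_of_mem ((isOpen_extChartAt_target x).mem_nhds hx)
      fun z hz => hΩ.exists_flat_isNormalFrame x hz)
    (christoffel_symm hcov.torsionFree x) hmet i d v v'
  refine (covTwoForm_coordField (hΩ.smooth i) x (e d) v v').trans (key.trans ?_)
  refine Finset.sum_congr rfl fun j _ => ?_
  rw [connectionForm_apply_basis Ω x h]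
  refine congrArg₂ _ ?_ (h0 j v v')
  simp only [hq]

/-- The covariant derivative of a form is linear in the direction. -/
theorem exists_linear_covTwoForm (cov : CovariantDerivative (𝓡 4) E4 (TangentSpace (𝓡 4) : X → Type _))
    (η : Form X 2) (x : X) (V W : (y : X) → TangentSpace (𝓡 4) y) :
    ∃ L : TangentSpace (𝓡 4) x →ₗ[ℝ] ℝ, ∀ u, L u = covTwoForm cov η x u V W := by
  have hal := two_add_left (η x).toAlternatingMap
  have har := two_add_right (η x).toAlternatingMap
  have hsl := two_smul_left (η x).toAlternatingMap
  have hsr := two_smul_right (η x).toAlternatingMap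
  simp only [ContinuousAlternatingMap.coe_toAlternatingMap] at hal har hsl hsr
  refine ⟨⟨⟨fun u => covTwoForm cov η x u V W, fun u u' => ?_⟩, fun r u => ?_⟩, fun u => rfl⟩
  · simp only [covTwoForm, map_add, hal, har]
    ring
  · simp only [covTwoForm, map_smul, hsl, hsr, smul_eq_mul, RingHom.id_apply]
    ring

theorem IsHypersymplectic.isConnectionMatrix_connectionForm (hΩ : IsHypersymplectic o Ω)
    (hcov : IsLeviCivita (Hypersymplectic.metric Ω) cov) :
    IsConnectionMatrix cov Ω (connectionForm Ω) := by
  intro i x u V W hV hW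
  obtain ⟨e, A, h, -⟩ := hΩ.exists_isNormalFrame x
  obtain ⟨L, hL⟩ := exists_linear_covTwoForm cov (Ω i) x V W
  -- Both sides are linear in the direction, so it suffices to compare them on the vectors of a
  -- normal frame, with the fields replaced by coordinate fields.
  have h1 : L = ∑ j, Ω j x ![V x, W x] • connectionForm Ω i j x := by
    refine e.ext fun d => ?_
    rw [hL, covTwoForm_eq_coordField (hΩ.smooth i) x (e d) hV hW, linear_sum_apply]
    refine (hΩ.covTwoForm_basis hcov x h i d (V x) (W x)).trans ?_
    exact Finset.sum_congr rfl fun j _ => mul_comm _ _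
  rw [← hL, h1, linear_sum_apply]
  exact Finset.sum_congr rfl fun j _ => mul_comm _ _

/-- Every pair of tangent vectors extends to coordinate fields, so two connection matrices differ by
a linear relation among the forms of the triple, which are independent. -/
theorem IsHypersymplectic.isConnectionMatrix_unique (hΩ : IsHypersymplectic o Ω)
    {a a' : Fin 3 → Fin 3 → (x : X) → TangentSpace (𝓡 4) x →ₗ[ℝ] ℝ}
    (ha : IsConnectionMatrix cov Ω a) (ha' : IsConnectionMatrix cov Ω a') (i j : Fin 3) (x : X) :
    a i j x = a' i j x := by
  ext u
  have h1 : ∑ j, (a i j x u - a' i j x u) • tripleAt Ω x j = 0 := by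
    ext v
    let p : E4 := v 0
    let r : E4 := v 1
    have hv : v = ![coordField x p x, coordField x r x] := by
      rw [coordField_self, coordField_self]
      exact fin_two_fun_eq v
    have h2 := ha i x u _ _ (diffAt_coordField x p) (diffAt_coordField x r)
    have h3 := ha' i x u _ _ (diffAt_coordField x p) (diffAt_coordField x r)
    rw [hv, alternating_sum_apply, AlternatingMap.zero_apply]
    have h4 := h2.symm.trans h3
    rw [← sub_eq_zero, ← Finset.sum_sub_distrib] at h4
    rw [← h4]
    exact Finset.sum_congr rfl fun k _ => sub_mul _ _ _
  exact sub_eq_zero.1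
    (Fintype.linearIndependent_iff.1 (hΩ.isFramingOfSelfDual x).1 _ h1 j)

end Connection

end Hypersymplectic

end

open Hypersymplectic in
theorem proposition3p6 {X : Type*} [TopologicalSpace X] [ChartedSpace E4 X]
    [IsManifold (𝓡 4) ∞ X] [T2Space X] [SecondCountableTopology X]
    (o : (x : X) → Orientation ℝ (TangentSpace (𝓡 4) x) (Fin 4))
    (Ω : Fin 3 → Form X 2) (hΩ : IsHypersymplectic o Ω) :
    IsFramingOfSelfDual o Ω ∧
      ∀ cov : CovariantDerivative (𝓡 4) E4 (TangentSpace (𝓡 4) : X → Type _),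
        IsLeviCivita (Hypersymplectic.metric Ω) cov →
          ∀ a : Fin 3 → Fin 3 → (x : X) → TangentSpace (𝓡 4) x →ₗ[ℝ] ℝ,
            IsConnectionMatrix cov Ω a ↔
              ∀ i j x, a i j x =
                (1 / 2 : ℝ) • dQQinv Ω i j x + ∑ k, (Q Ω x)⁻¹ k j • matX Ω i k x := by
  refine ⟨hΩ.isFramingOfSelfDual, fun cov hcov a => ⟨fun ha => ?_, fun ha => ?_⟩⟩
  · exact hΩ.isConnectionMatrix_unique ha (hΩ.isConnectionMatrix_connectionForm hcov)
  · have : a = connectionForm Ω := by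
      funext i j x
      exact ha i j x
    rw [this]
    exact hΩ.isConnectionMatrix_connectionForm hcov
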